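/- Let $(X_t,(\mathbb P_x)_{x\in E})$ be a conservative, time-homogeneous, measurable Markov process in continuous time on a Polish space $E$, with semigroup $(P_t)_{t\ge 0}$, and let $\mu$ be an invariant probability measure. Let $L$, with domain $D(L)$, be the generator of $(P_t)$ in $\mathbb L^2(\mu)$, and write $\langle f,g\rangle_\mu=\int fg\,d\mu$ and $\mathbb P_\nu=\int\mathbb P_x\,\nu(dx)$. Let $F$ be a real function on $]0,+\infty[$ that is continuous, increasing and concave, with $F(x)\to+\infty$ as $x\to+\infty$, $F(1)=0$ and $F(xy)\le F(x)+F(y)$ for all $x,y>0$. Put $F(0)=\lim_{x\downarrow 0}F(x)\in[-\infty,0[$ and $F(+\infty)=+\infty$, and let $F^{-1}:\,]F(0),+\infty[\,\to\,]0,+\infty[$ be the inverse function. Assume that $\mu$ satisfies the $F$-Sobolev inequality $$\int f^2F(f^2)\,d\mu\le-\langle Lf,f\rangle_\mu\qquad\text{for all } f\in D(L)\text{ with }\int f^2d\mu=1,$$ the left-hand integral being, in particular, finite. Let $V\in\mathbb L^1(\mu)$. For a $\mu$-integrable function $W$ let $\lambda_W\in[0,+\infty]$ be the largest number such that $\lambda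 W>F(0)$ $\mu$-a.e. for all $0\le\lambda<\lambda_W$, and put $$H^*_W(a)=\sup_{0\le\lambda<\lambda_W}\Big\{\lambda a-F\Big(\int F^{-1}(\lambda W)\,d\mu\Big)\Big\}\in[-\infty,+\infty],\qquad H^*=H^*_V,\qquad H^*_c=H^*_{V-\int V d\mu}.$$ (i) For every probability measure $\nu\ll\mu$, all $t>0$ and all $R>0$, $$\mathbb P_\nu\Big(\frac1t\int_0^tV(X_s)\,ds-\int V\,d\mu\ge R\Big)\le\Big\|\frac{d\nu}{d\mu}\Big\|_{\mathbb L^2(\mu)}\exp\Big(-t\,H^*\Big(R+\int V\,d\mu\Big)\Big)$$ and $$\mathbb P_\nu\Big(\frac1t\int_0^tV(X_s)\,ds-\int V\,d\mu\ge R\Big)\le\Big\|\frac{d\nu}{d\mu}\Big\|_{\mathbb L^2(\mu)}\exp\big(-t\,H_c^*(R)\big).$$ (ii) If $F(0)=-\infty$, the second bound is at least as good as the first: $H^*(R+\int V\,d\mu)\le H^*_c(R)$ for all $R>0$. (iii) For all $0\le\lambda<\lambda_V$, $$\Lambda(\lambda V):=\sup\Big\{\int\lambda Vf^2\,d\mu+\langle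 Lf,f\rangle_\mu\;;\;f\in D(L),\ \int f^2d\mu=1\Big\}\le F\Big(\int F^{-1}(\lambda V)\,d\mu\Big).$$ -/

import Mathlib

open MeasureTheory ProbabilityTheory Filter Topology Set
open scoped NNReal ENNReal

noncomputable section

/-- A conservative, time-homogeneous Markov process `(X_t, (ℙ_x)_{x ∈ E})` in continuous time,
with state space `E`, realised on a measurable space `Ω`. The process is jointly measurable in
`(t, ω)`, so that the time integrals `∫₀ᵗ V (X_s) ds` make sense. -/
structure MarkovProcess (E Ω : Type*) [MeasurableSpace E] [MeasurableSpace Ω] where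
  /-- the process `X_t` -/
  X : ℝ≥0 → Ω → E
  /-- the laws `ℙ_x` -/
  law : Kernel E Ω
  /-- each `ℙ_x` is a probability measure -/
  isMarkovKernel : IsMarkovKernel law
  measurable_X : Measurable fun p : ℝ≥0 × Ω => X p.1 p.2
  /-- under `ℙ_x` the process starts from `x` -/
  start : ∀ x, ∀ᵐ ω ∂(law x), X 0 ω = x
  /-- the Markov property with respect to the natural filtration:
  `ℙ_x (X_{s+t} ∈ B | σ(X_u, u ≤ s)) = ℙ_{X_s} (X_t ∈ B)` -/
  markov : ∀ (x : E) (s t : ℝ≥0) (A : Set Ω),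
    MeasurableSet[⨆ u : {u : ℝ≥0 // u ≤ s}, MeasurableSpace.comap (X u) inferInstance] A →
    ∀ B : Set E, MeasurableSet B →
      law x (A ∩ X (s + t) ⁻¹' B) = ∫⁻ ω in A, law (X s ω) (X t ⁻¹' B) ∂(law x)

namespace MarkovProcess

variable {E Ω : Type*} [MeasurableSpace E] [MeasurableSpace Ω]

/-- The law `ℙ_ν = ∫ ℙ_x ν(dx)` of the process with initial distribution `ν`. -/
def initLaw (M : MarkovProcess E Ω) (ν : Measure E) : Measure Ω :=
  ν.bind M.law

/-- The transition kernel `P_t(x, dy) = ℙ_x (X_t ∈ dy)`. -/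
def transition (M : MarkovProcess E Ω) (t : ℝ≥0) : Kernel E E :=
  M.law.map (M.X t)

/-- The semigroup `P_t f (x) = 𝔼_x [f (X_t)]`. -/
def semigroup (M : MarkovProcess E Ω) (t : ℝ≥0) (f : E → ℝ) (x : E) : ℝ :=
  ∫ y, f y ∂(M.transition t x)

/-- `μ` is invariant for the semigroup: `μ P_t = μ` for all `t`. -/
def IsInvariant (M : MarkovProcess E Ω) (μ : Measure E) : Prop :=
  ∀ t : ℝ≥0, (M.transition t).Invariant μ

/-- `f ∈ D(L)` and `L f = g`, where `L` is the infinitesimal generator of `(P_t)` in `𝕃²(μ)`: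
`f, g ∈ 𝕃²(μ)` and `(P_t f - f) / t → g` in `𝕃²(μ)` as `t ↓ 0`. -/
def HasGenerator (M : MarkovProcess E Ω) (μ : Measure E) (f g : E → ℝ) : Prop :=
  MemLp f 2 μ ∧ MemLp g 2 μ ∧
    Tendsto
      (fun t : ℝ≥0 => eLpNorm (fun x => (M.semigroup t f x - f x) / (t : ℝ) - g x) 2 μ)
      (𝓝[>] 0) (𝓝 0)

/-- The `F`-Sobolev inequality `∫ f² F(f²) dμ ≤ - ⟨L f, f⟩_μ` for all `f ∈ D(L)` with
`∫ f² dμ = 1`. The left-hand side has to be finite; this is the integrability clause. -/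
def FSobolev (M : MarkovProcess E Ω) (μ : Measure E) (F : ℝ → ℝ) : Prop :=
  ∀ f g : E → ℝ, M.HasGenerator μ f g → ∫ x, f x ^ 2 ∂μ = 1 →
    Integrable (fun x => f x ^ 2 * F (f x ^ 2)) μ ∧
      ∫ x, f x ^ 2 * F (f x ^ 2) ∂μ ≤ - ∫ x, g x * f x ∂μ

/-- `Λ(W) = sup { ∫ W f² dμ + ⟨L f, f⟩_μ ; f ∈ D(L), ∫ f² dμ = 1 }`, with values in `[-∞, +∞]`;
the first integral is the difference of the integrals of the positive and negative parts. -/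
def Lam (M : MarkovProcess E Ω) (μ : Measure E) (W : E → ℝ) : EReal :=
  sSup {r : EReal | ∃ f g : E → ℝ, M.HasGenerator μ f g ∧ ∫ x, f x ^ 2 ∂μ = 1 ∧
    r = (((∫⁻ x, ENNReal.ofReal (W x * f x ^ 2) ∂μ : ℝ≥0∞) : EReal)
          - ((∫⁻ x, ENNReal.ofReal (-(W x * f x ^ 2)) ∂μ : ℝ≥0∞) : EReal))
        + ((∫ x, g x * f x ∂μ : ℝ) : EReal)}

/-- The time average `(1/t) ∫₀ᵗ V(X_s) ds`. -/
def timeAverage (M : MarkovProcess E Ω) (V : E → ℝ) (t : ℝ) (ω : Ω) : ℝ :=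
  (1 / t) * ∫ s in (0 : ℝ)..t, V (M.X s.toNNReal ω)

end MarkovProcess

/-- `F(0) = lim_{x ↓ 0} F(x) = inf_{x > 0} F(x) ∈ [-∞, +∞)` for an increasing function `F`
on `]0, +∞[`. -/
def valueAtZero (F : ℝ → ℝ) : EReal :=
  ⨅ x : Ioi (0 : ℝ), ((F x : ℝ) : EReal)

/-- The continuous extension of an increasing `F` that tends to `+∞`, to `[0, +∞]`. -/
def extendF (F : ℝ → ℝ) (y : ℝ≥0∞) : EReal :=
  if y = 0 then valueAtZero F else if y = ∞ then ⊤ else ((F y.toReal : ℝ) : EReal)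

/-- The inverse `F⁻¹ : ]F(0), +∞[ → ]0, +∞[` of `F` (arbitrary outside of `]F(0), +∞[`). -/
def inverseF (F : ℝ → ℝ) : ℝ → ℝ :=
  Function.invFunOn F (Ioi 0)

section

variable {E : Type*} [MeasurableSpace E]

/-- `F (∫ F⁻¹(W) dμ)`, with value `+∞` when `F⁻¹(W)` is not integrable. -/
def sobolevFunctional (μ : Measure E) (F : ℝ → ℝ) (W : E → ℝ) : EReal :=
  extendF F (∫⁻ x, ENNReal.ofReal (inverseF F (W x)) ∂μ)

/-- `λ_V ∈ [0, +∞]`: the largest `ℓ` such that `λ V > F(0)` (`μ`-a.e.) for all `0 ≤ λ < ℓ`. -/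
def lambdaMax (μ : Measure E) (F : ℝ → ℝ) (V : E → ℝ) : EReal :=
  sSup {l : EReal | ∀ c : ℝ, 0 ≤ c → (c : EReal) < l →
    ∀ᵐ x ∂μ, valueAtZero F < ((c * V x : ℝ) : EReal)}

/-- `H*(a) = sup_{0 ≤ λ < λ_V} (λ a - F (∫ F⁻¹(λ V) dμ)) ∈ [-∞, +∞]`. -/
def Hstar (μ : Measure E) (F : ℝ → ℝ) (V : E → ℝ) (a : ℝ) : EReal :=
  ⨆ (c : ℝ) (_ : 0 ≤ c ∧ (c : EReal) < lambdaMax μ F V),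
    ((c * a : ℝ) : EReal) - sobolevFunctional μ F (fun x => c * V x)

/-- `H_c*`: the function `H*` of the centred function `V - ∫ V dμ`. -/
def HstarC (μ : Measure E) (F : ℝ → ℝ) (V : E → ℝ) (a : ℝ) : EReal :=
  Hstar μ F (fun x => V x - ∫ y, V y ∂μ) a

/-- `‖dν/dμ‖` in `𝕃²(μ)`. -/
def densityNorm (ν μ : Measure E) : ℝ≥0∞ :=
  eLpNorm (fun x => (ν.rnDeriv μ x).toReal) 2 μ

end

end

/-!
The hypotheses force `F = k log` for some `k > 0`: subadditivity and the tangent `k (x - 1)` at `1`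
give `F x ≤ n F (x ^ (1 / n)) ≤ k n (x ^ (1 / n) - 1) → k log x`, and `0 = F 1 ≤ F x + F x⁻¹` turns
this into the reverse inequality. So `F (∫ F⁻¹ W dμ)` is `k log ∫ exp (W / k) dμ`. It dominates
`Λ(W)` by the entropy inequality, and adding a constant to `W` shifts it by that constant, whence
`H_c^*(R) = H^*(R + ∫ V dμ)`.

For bounded `W` the Feynman–Kac function `u_t(x) = 𝔼_x exp ∫₀ᵗ W(X_s) ds` lies in `D(L)`, with
`∂_t u = L u + W u` in `𝕃²(μ)`. Hence `(‖u_t‖²)' = 2 (⟨L u_t, u_t⟩ + ∫ W u_t² dμ) ≤ 2 Λ(W) ‖u_t‖²`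
and `‖u_t‖ ≤ exp (t Λ(W))`. By Cauchy–Schwarz
`𝔼_ν exp ∫₀ᵗ W(X_s) ds = ∫ u_t (dν/dμ) dμ ≤ ‖dν/dμ‖ exp (t Λ(W))`; truncation removes the
boundedness of `W`, and the exponential Chebyshev inequality gives the deviation bounds.
-/

theorem absolutelyContinuousOnInterval_pow_succ {f : ℝ → ℝ} {a b : ℝ}
    (hf : AbsolutelyContinuousOnInterval f a b) (n : ℕ) :
    AbsolutelyContinuousOnInterval (fun x => f x ^ (n + 1)) a b := by
  induction n with
  | zero => simpa using hf
  | succ n ih => simpa only [← pow_succ] using ih.fun_mul hf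

theorem integral_mul_integral_pow_div_factorial {w : ℝ → ℝ} {a b : ℝ}
    (hw : IntervalIntegrable w volume a b) (n : ℕ) :
    ∫ r in a..b, w r * ((∫ s in r..b, w s) ^ n / n.factorial) =
      (∫ s in a..b, w s) ^ (n + 1) / (n + 1).factorial := by
  let G : ℝ → ℝ := fun r => ∫ s in b..r, w s
  have hG (r : ℝ) : ∫ s in r..b, w s = -G r := intervalIntegral.integral_symm _ _
  have hG_ac : AbsolutelyContinuousOnInterval (fun r => G r ^ (n + 1)) a b :=
    absolutelyContinuousOnInterval_pow_succ
      (hw.absolutelyContinuousOnInterval_intervalIntegral (by simp)) n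
  have hG_deriv : ∀ᵐ r, r ∈ uIoc a b →
      deriv (fun r => G r ^ (n + 1)) r = (n + 1) * G r ^ n * w r := by
    filter_upwards [hw.ae_hasDerivAt_integral] with r hr hr_mem
    simpa using ((hr (uIoc_subset_uIcc hr_mem) b (by simp)).fun_pow (n + 1)).deriv
  have hG_int : ∫ r in a..b, (n + 1) * G r ^ n * w r = -G a ^ (n + 1) := by
    rw [← intervalIntegral.integral_congr_ae hG_deriv, hG_ac.integral_deriv_eq_sub]
    simp [G]
  calc ∫ r in a..b, w r * ((∫ s in r..b, w s) ^ n / n.factorial)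
      = ∫ r in a..b, (-1) ^ n / (n + 1).factorial * ((n + 1) * G r ^ n * w r) := by
        refine intervalIntegral.integral_congr fun r _ => ?_
        simp only [hG, neg_pow (G r), Nat.factorial_succ]
        push_cast
        field_simp
    _ = (∫ s in a..b, w s) ^ (n + 1) / (n + 1).factorial := by
        rw [intervalIntegral.integral_const_mul, hG_int, hG, neg_pow (G a)]
        ring

theorem lintegral_ofReal_mul_integral_pow_div_factorial {w : ℝ → ℝ} {a b : ℝ} (hab : a ≤ b)
    (hw : IntervalIntegrable w volume a b) (hw_nonneg : ∀ s, 0 ≤ w s) (n : ℕ) :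
    ∫⁻ r in Ioc a b, ENNReal.ofReal (w r) *
        ENNReal.ofReal ((∫ s in r..b, w s) ^ n / n.factorial) =
      ENNReal.ofReal ((∫ s in a..b, w s) ^ (n + 1) / (n + 1).factorial) := by
  have h_cont : ContinuousOn (fun r => (∫ s in r..b, w s) ^ n / n.factorial) (uIcc a b) :=
    ((intervalIntegral.continuousOn_primitive_interval_left
      ((intervalIntegrable_iff' (by simp)).mp hw)).pow n).div_const _
  have h_nonneg : ∀ r ∈ Ioc a b, 0 ≤ w r * ((∫ s in r..b, w s) ^ n / n.factorial) :=
    fun r hr => mul_nonneg (hw_nonneg r) (div_nonneg (pow_nonneg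
      (intervalIntegral.integral_nonneg hr.2 fun s _ => hw_nonneg s) n) (by positivity))
  rw [← integral_mul_integral_pow_div_factorial hw, intervalIntegral.integral_of_le hab,
    ofReal_integral_eq_lintegral_ofReal
      ((hw.mul_continuousOn h_cont).1) (ae_restrict_of_forall_mem measurableSet_Ioc h_nonneg)]
  exact lintegral_congr fun r => (ENNReal.ofReal_mul (hw_nonneg r)).symm

theorem lintegral_mul_lintegral_comm {α β : Type*} [MeasurableSpace α] [MeasurableSpace β]
    {μ : Measure α} {ν : Measure β} [SFinite μ] [SFinite ν] {g : α → ℝ≥0∞}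
    {k : α → β → ℝ≥0∞} (hg : Measurable g) (hk : Measurable (Function.uncurry k)) :
    ∫⁻ a, g a * ∫⁻ b, k a b ∂ν ∂μ = ∫⁻ b, ∫⁻ a, g a * k a b ∂μ ∂ν := by
  rw [← lintegral_lintegral_swap ((hg.comp measurable_fst).mul hk).aemeasurable]
  exact lintegral_congr fun a => (lintegral_const_mul _ (hk.comp measurable_prodMk_left)).symm

namespace MarkovProcess

variable {E Ω : Type*} [MeasurableSpace E] [MeasurableSpace Ω]

/-- The additive functional `∫ₐᵇ W (X_s) ds`. -/
noncomputable def pathIntegral (M : MarkovProcess E Ω) (W : E → ℝ) (a b : ℝ) (ω : Ω) : ℝ :=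
  ∫ s in a..b, W (M.X s.toNNReal ω)

/-- The `σ`-algebra generated by the process up to time `s`. -/
@[reducible]
def past (M : MarkovProcess E Ω) (s : ℝ≥0) : MeasurableSpace Ω :=
  ⨆ u : {u : ℝ≥0 // u ≤ s}, MeasurableSpace.comap (M.X u) inferInstance

variable (M : MarkovProcess E Ω)

instance : IsMarkovKernel M.law := M.isMarkovKernel

theorem measurable_eval (s : ℝ≥0) : Measurable (M.X s) :=
  M.measurable_X.comp measurable_prodMk_left

theorem measurable_path {W : E → ℝ} (hW : Measurable W) :
    Measurable fun p : ℝ × Ω => W (M.X p.1.toNNReal p.2) := by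
  have : Measurable fun p : ℝ × Ω => ((p.1.toNNReal, p.2) : ℝ≥0 × Ω) := by fun_prop
  exact hW.comp (M.measurable_X.comp this)

theorem past_le (s : ℝ≥0) : M.past s ≤ ‹MeasurableSpace Ω› :=
  iSup_le fun u => (M.measurable_eval u).comap_le

theorem past_mono {s t : ℝ≥0} (h : s ≤ t) : M.past s ≤ M.past t :=
  iSup_le fun u => le_iSup (fun u : {u : ℝ≥0 // u ≤ t} =>
    MeasurableSpace.comap (M.X u) inferInstance) ⟨u.1, u.2.trans h⟩

theorem measurable_eval_past (s : ℝ≥0) : Measurable[M.past s] (M.X s) := by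
  have : MeasurableSpace.comap (M.X s) inferInstance ≤ M.past s :=
    le_iSup (fun u : {u : ℝ≥0 // u ≤ s} =>
      MeasurableSpace.comap (M.X u) inferInstance) ⟨s, le_rfl⟩
  exact (comap_measurable (M.X s)).mono this le_rfl

instance (t : ℝ≥0) : IsMarkovKernel (M.transition t) :=
  Kernel.IsMarkovKernel.map _ (M.measurable_eval t)

theorem lintegral_transition (t : ℝ≥0) (x : E) {φ : E → ℝ≥0∞} (hφ : Measurable φ) :
    ∫⁻ y, φ y ∂(M.transition t x) = ∫⁻ ω, φ (M.X t ω) ∂(M.law x) := by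
  rw [transition, Kernel.map_apply _ (M.measurable_eval t),
    lintegral_map hφ (M.measurable_eval t)]

theorem setLIntegral_eval_add (x : E) (s t : ℝ≥0) {A : Set Ω} (hA : MeasurableSet[M.past s] A)
    {φ : E → ℝ≥0∞} (hφ : Measurable φ) :
    ∫⁻ ω in A, φ (M.X (s + t) ω) ∂(M.law x) =
      ∫⁻ ω in A, ∫⁻ y, φ y ∂(M.transition t (M.X s ω)) ∂(M.law x) := by
  have map_eq_bind : ((M.law x).restrict A).map (M.X (s + t)) =
      (((M.law x).restrict A).map (M.X s)).bind (M.transition t) := by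
    ext B hB
    rw [Measure.map_apply (M.measurable_eval _) hB,
      Measure.restrict_apply (M.measurable_eval _ hB),
      Measure.bind_apply hB (Kernel.aemeasurable _),
      lintegral_map (Kernel.measurable_coe _ hB) (M.measurable_eval _), inter_comm,
      M.markov x s t A hA B hB]
    exact lintegral_congr fun ω => (Kernel.map_apply' _ (M.measurable_eval t) _ hB).symm
  rw [← lintegral_map hφ (M.measurable_eval _), map_eq_bind,
    Measure.lintegral_bind (Kernel.aemeasurable _) hφ.aemeasurable,
    lintegral_map (Measurable.lintegral_kernel hφ) (M.measurable_eval _)]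

theorem lintegral_mul_eval_add (x : E) (s t : ℝ≥0) {g : Ω → ℝ≥0∞} (hg : Measurable[M.past s] g)
    {φ : E → ℝ≥0∞} (hφ : Measurable φ) :
    ∫⁻ ω, g ω * φ (M.X (s + t) ω) ∂(M.law x) =
      ∫⁻ ω, g ω * ∫⁻ y, φ y ∂(M.transition t (M.X s ω)) ∂(M.law x) := by
  have hφ_eval : Measurable fun ω => φ (M.X (s + t) ω) := hφ.comp (M.measurable_eval _)
  have hPφ_eval : Measurable fun ω => ∫⁻ y, φ y ∂(M.transition t (M.X s ω)) :=
    (Measurable.lintegral_kernel hφ).comp (M.measurable_eval _)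
  have hg' : Measurable g := hg.mono (M.past_le s) le_rfl
  have trim_eq : (((M.law x).withDensity fun ω => φ (M.X (s + t) ω)).trim (M.past_le s)) =
      ((M.law x).withDensity
        fun ω => ∫⁻ y, φ y ∂(M.transition t (M.X s ω))).trim (M.past_le s) := by
    refine @Measure.ext _ (M.past s) _ _ fun A hA => ?_
    rw [trim_measurableSet_eq _ hA, trim_measurableSet_eq _ hA,
      withDensity_apply _ (M.past_le s _ hA), withDensity_apply _ (M.past_le s _ hA),
      M.setLIntegral_eval_add x s t hA hφ]
  simp only [mul_comm (g _)]
  calc ∫⁻ ω, φ (M.X (s + t) ω) * g ω ∂(M.law x)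
      = ∫⁻ ω, g ω ∂((M.law x).withDensity fun ω => φ (M.X (s + t) ω)) :=
        (lintegral_withDensity_eq_lintegral_mul _ hφ_eval hg').symm
    _ = ∫⁻ ω, g ω ∂((M.law x).withDensity
          fun ω => ∫⁻ y, φ y ∂(M.transition t (M.X s ω))) := by
        rw [← lintegral_trim (M.past_le s) hg, trim_eq, lintegral_trim (M.past_le s) hg]
    _ = ∫⁻ ω, (∫⁻ y, φ y ∂(M.transition t (M.X s ω))) * g ω ∂(M.law x) :=
        lintegral_withDensity_eq_lintegral_mul _ hPφ_eval hg'

theorem measurable_lintegral_transition {α : Type*} [MeasurableSpace α] {r : α → ℝ≥0}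
    {x : α → E} {φ : α → E → ℝ≥0∞} (hr : Measurable r) (hx : Measurable x)
    (hφ : Measurable (Function.uncurry φ)) :
    Measurable fun a => ∫⁻ y, φ a y ∂(M.transition (r a) (x a)) := by
  have h_eval : Measurable fun q : α × Ω => M.X (r q.1) q.2 :=
    M.measurable_X.comp ((hr.comp measurable_fst).prodMk measurable_snd)
  have h_lintegral : Measurable fun a => ∫⁻ ω, φ a (M.X (r a) ω) ∂(M.law.comap x hx a) :=
    (hφ.comp (measurable_fst.prodMk h_eval)).lintegral_kernel_prod_right'
  simpa only [M.lintegral_transition _ _ hφ.of_uncurry_left, Kernel.comap_apply]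
    using h_lintegral

/-- The iterated integrals of the Dyson expansion `∑ₙ Dₙ(t)` of the Feynman-Kac semigroup
applied to `1`: `D₀ = 1` and `Dₙ₊₁(t) = ∫₀ᵗ P_r (W Dₙ(t - r)) dr`, for a potential `W ≥ 0`.
The Markov property is only given for one later time, while `exp ∫ W (X_s) ds` depends on the whole
future path; each term of the expansion is reached by finitely many applications of it. -/
noncomputable def dyson (W : E → ℝ) : ℕ → ℝ → E → ℝ≥0∞
  | 0, _, _ => 1
  | n + 1, t, x => ∫⁻ r in Ioc 0 t, ∫⁻ y, ENNReal.ofReal (W y) * dyson W n (t - r) y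
      ∂(M.transition r.toNNReal x)

variable {M} {W : E → ℝ} {B : ℝ}

theorem locallyIntegrable_path (hW : Measurable W) (hB : ∀ x, |W x| ≤ B) (ω : Ω) :
    LocallyIntegrable fun s : ℝ => W (M.X s.toNNReal ω) :=
  (locallyIntegrable_const B).mono
    ((M.measurable_path hW).comp measurable_prodMk_right).aestronglyMeasurable
    (Eventually.of_forall fun _ => (hB _).trans (le_abs_self B))

theorem intervalIntegrable_path (hW : Measurable W) (hB : ∀ x, |W x| ≤ B) (ω : Ω) (a b : ℝ) :
    IntervalIntegrable (fun s : ℝ => W (M.X s.toNNReal ω)) volume a b :=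
  intervalIntegrable_iff.mpr (((locallyIntegrable_path hW hB ω).integrableOn_isCompact
    isCompact_uIcc).mono_set uIoc_subset_uIcc)

theorem measurable_pathIntegral (hW : Measurable W) (a b : ℝ) :
    Measurable (M.pathIntegral W a b) := by
  have h_path : StronglyMeasurable fun p : Ω × ℝ => W (M.X p.2.toNNReal p.1) :=
    ((M.measurable_path hW).comp measurable_swap).stronglyMeasurable
  exact (h_path.integral_prod_right' (ν := volume.restrict (Ioc a b))).measurable.sub
    (h_path.integral_prod_right' (ν := volume.restrict (Ioc b a))).measurable

theorem continuous_pathIntegral_left (hW : Measurable W) (hB : ∀ x, |W x| ≤ B) (b : ℝ) (ω : Ω) :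
    Continuous fun a => M.pathIntegral W a b ω := by
  simp only [pathIntegral, intervalIntegral.integral_symm b]
  exact (intervalIntegral.continuous_primitive (intervalIntegrable_path hW hB ω) b).neg

theorem measurable_uncurry_pathIntegral_left (hW : Measurable W) (hB : ∀ x, |W x| ≤ B) (b : ℝ) :
    Measurable fun p : ℝ × Ω => M.pathIntegral W p.1 b p.2 :=
  measurable_uncurry_of_continuous_of_measurable (continuous_pathIntegral_left hW hB b)
    (measurable_pathIntegral hW · b)

theorem abs_pathIntegral_le (hB : ∀ x, |W x| ≤ B) (a b : ℝ) (ω : Ω) :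
    |M.pathIntegral W a b ω| ≤ B * |b - a| := by
  rw [← Real.norm_eq_abs]
  exact intervalIntegral.norm_integral_le_of_norm_le_const fun _ _ => hB _

theorem pathIntegral_nonneg (hW_nonneg : ∀ x, 0 ≤ W x) {a b : ℝ} (hab : a ≤ b) (ω : Ω) :
    0 ≤ M.pathIntegral W a b ω :=
  intervalIntegral.integral_nonneg hab fun _ _ => hW_nonneg _

theorem pathIntegral_add_const (hW : Measurable W) (hB : ∀ x, |W x| ≤ B) (c a b : ℝ) (ω : Ω) :
    M.pathIntegral (fun x => W x + c) a b ω = M.pathIntegral W a b ω + c * (b - a) := by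
  simp only [pathIntegral]
  rw [intervalIntegral.integral_add (intervalIntegrable_path hW hB ω a b)
    intervalIntegrable_const]
  simp [mul_comm c]

theorem pathIntegral_add_left (s a b : ℝ) (ω : Ω) :
    M.pathIntegral W (s + a) (s + b) ω = ∫ r in a..b, W (M.X (s + r).toNNReal ω) :=
  (intervalIntegral.integral_comp_add_left (fun r => W (M.X r.toNNReal ω)) s).symm

theorem measurable_dyson (hW : Measurable W) (n : ℕ) :
    Measurable fun p : ℝ × E => M.dyson W n p.1 p.2 := by
  induction n with
  | zero => exact measurable_const
  | succ n ih =>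
    have h_domain : MeasurableSet {q : (ℝ × E) × ℝ | q.2 ∈ Ioc 0 q.1.1} :=
      (measurableSet_lt measurable_const measurable_snd).inter
        (measurableSet_le measurable_snd (measurable_fst.comp measurable_fst))
    have h_integrand : Measurable fun q : (ℝ × E) × ℝ =>
        ∫⁻ y, ENNReal.ofReal (W y) * M.dyson W n (q.1.1 - q.2) y
          ∂(M.transition q.2.toNNReal q.1.2) :=
      M.measurable_lintegral_transition (by fun_prop) (by fun_prop)
        ((hW.comp measurable_snd).ennreal_ofReal.mul (ih.comp
          (f := fun q : ((ℝ × E) × ℝ) × E => (q.1.1.1 - q.1.2, q.2)) (by fun_prop)))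
    convert (h_integrand.indicator h_domain).lintegral_prod_right' (ν := volume) using 2 with p
    exact (lintegral_indicator measurableSet_Ioc _).symm

theorem lintegral_mul_dyson_succ (hW : Measurable W) (n : ℕ) (x : E) (s : ℝ≥0) (t : ℝ)
    {g : Ω → ℝ≥0∞} (hg : Measurable[M.past s] g) :
    ∫⁻ ω, g ω * M.dyson W (n + 1) t (M.X s ω) ∂(M.law x) =
      ∫⁻ r in Ioc 0 t, ∫⁻ ω, g ω * (ENNReal.ofReal (W (M.X (s + r.toNNReal) ω)) *
        M.dyson W n (t - r) (M.X (s + r.toNNReal) ω)) ∂(M.law x) := by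
  let K (r : ℝ) (y : E) : ℝ≥0∞ := ENNReal.ofReal (W y) * M.dyson W n (t - r) y
  have hK : Measurable fun p : ℝ × E => K p.1 p.2 :=
    (hW.comp measurable_snd).ennreal_ofReal.mul ((measurable_dyson hW n).comp
      (f := fun p : ℝ × E => (t - p.1, p.2)) (by fun_prop))
  have hPK : Measurable fun p : Ω × ℝ =>
      ∫⁻ y, K p.2 y ∂(M.transition p.2.toNNReal (M.X s p.1)) :=
    M.measurable_lintegral_transition (by fun_prop) ((M.measurable_eval s).comp measurable_fst)
      (hK.comp (f := fun q : (Ω × ℝ) × E => (q.1.2, q.2)) (by fun_prop))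
  calc ∫⁻ ω, g ω * M.dyson W (n + 1) t (M.X s ω) ∂(M.law x)
      = ∫⁻ r in Ioc 0 t, ∫⁻ ω, g ω *
          ∫⁻ y, K r y ∂(M.transition r.toNNReal (M.X s ω)) ∂(M.law x) :=
        lintegral_mul_lintegral_comm (hg.mono (M.past_le s) le_rfl) hPK
    _ = ∫⁻ r in Ioc 0 t, ∫⁻ ω, g ω * K r (M.X (s + r.toNNReal) ω) ∂(M.law x) :=
        lintegral_congr fun r =>
          (M.lintegral_mul_eval_add x s _ hg (hK.comp measurable_prodMk_left)).symm

theorem lintegral_mul_pathIntegral_pow_succ (hW : Measurable W) (hB : ∀ x, |W x| ≤ B)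
    (hW_nonneg : ∀ x, 0 ≤ W x) (n : ℕ) (P : Measure Ω) [SFinite P] (s : ℝ≥0) {t : ℝ}
    (ht : 0 ≤ t) {g : Ω → ℝ≥0∞} (hg : Measurable g) :
    ∫⁻ ω, g ω * ENNReal.ofReal (M.pathIntegral W s (s + t) ω ^ (n + 1) / (n + 1).factorial) ∂P =
      ∫⁻ r in Ioc 0 t, ∫⁻ ω, g ω * (ENNReal.ofReal (W (M.X (s + r.toNNReal) ω)) *
        ENNReal.ofReal (M.pathIntegral W (s + r) (s + t) ω ^ n / n.factorial)) ∂P := by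
  let J (ω : Ω) (r : ℝ) : ℝ≥0∞ := ENNReal.ofReal (W (M.X (s + r).toNNReal ω)) *
    ENNReal.ofReal (M.pathIntegral W (s + r) (s + t) ω ^ n / n.factorial)
  have hJ : Measurable fun p : Ω × ℝ => J p.1 p.2 := by
    have h_shift : Measurable fun p : Ω × ℝ => ((s + p.2, p.1) : ℝ × Ω) := by fun_prop
    exact ((M.measurable_path hW).comp h_shift).ennreal_ofReal.mul
      ((((measurable_uncurry_pathIntegral_left hW hB _).comp h_shift).pow_const
        n).div_const _).ennreal_ofReal
  have h_path (ω : Ω) : ENNReal.ofReal (M.pathIntegral W s (s + t) ω ^ (n + 1) /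
      (n + 1).factorial) = ∫⁻ r in Ioc 0 t, J ω r := by
    have h_int := (intervalIntegrable_path (M := M) hW hB ω (s + 0) (s + t)).comp_add_left (s : ℝ)
    rw [add_sub_cancel_left, add_sub_cancel_left] at h_int
    have h_expand := lintegral_ofReal_mul_integral_pow_div_factorial ht h_int
      (fun _ => hW_nonneg _) n
    simp only [← pathIntegral_add_left, add_zero] at h_expand
    exact h_expand.symm
  simp only [h_path]
  rw [lintegral_mul_lintegral_comm hg hJ]
  refine setLIntegral_congr_fun measurableSet_Ioc fun r hr => ?_
  simp only [J, Real.toNNReal_add s.coe_nonneg hr.1.le, Real.toNNReal_coe]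

theorem lintegral_mul_pathIntegral_pow_div_factorial (hW : Measurable W) (hB : ∀ x, |W x| ≤ B)
    (hW_nonneg : ∀ x, 0 ≤ W x) (n : ℕ) (x : E) (s : ℝ≥0) {t : ℝ} (ht : 0 ≤ t) {g : Ω → ℝ≥0∞}
    (hg : Measurable[M.past s] g) :
    ∫⁻ ω, g ω * ENNReal.ofReal (M.pathIntegral W s (s + t) ω ^ n / n.factorial) ∂(M.law x) =
      ∫⁻ ω, g ω * M.dyson W n t (M.X s ω) ∂(M.law x) := by
  induction n generalizing s t g with
  | zero => simp [dyson]
  | succ n ih =>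
    rw [lintegral_mul_dyson_succ hW n x s t hg, lintegral_mul_pathIntegral_pow_succ hW hB
      hW_nonneg n _ s ht (hg.mono (M.past_le s) le_rfl)]
    refine setLIntegral_congr_fun measurableSet_Ioc fun r hr => ?_
    lift r to ℝ≥0 using hr.1.le
    have h_weight : Measurable[M.past (s + r)]
        fun ω => g ω * ENNReal.ofReal (W (M.X (s + r) ω)) :=
      (hg.mono (M.past_mono le_self_add) le_rfl).mul
        (hW.comp (M.measurable_eval_past _)).ennreal_ofReal
    have h_time : (s + r + (t - r) : ℝ) = s + t := by ring
    simpa only [h_time, NNReal.coe_add, Real.toNNReal_coe, mul_assoc]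
      using ih (s + r) (sub_nonneg.mpr hr.2) h_weight

theorem lintegral_exp_pathIntegral (hW : Measurable W) (hB : ∀ x, |W x| ≤ B)
    (hW_nonneg : ∀ x, 0 ≤ W x) (x : E) (s : ℝ≥0) {t : ℝ} (ht : 0 ≤ t) :
    ∫⁻ ω, ENNReal.ofReal (Real.exp (M.pathIntegral W s (s + t) ω)) ∂(M.law x) =
      ∫⁻ ω, ∑' n, M.dyson W n t (M.X s ω) ∂(M.law x) := by
  have exp_eq_tsum (ω : Ω) : ENNReal.ofReal (Real.exp (M.pathIntegral W s (s + t) ω)) =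
      ∑' n : ℕ, ENNReal.ofReal (M.pathIntegral W s (s + t) ω ^ n / n.factorial) := by
    have h_nonneg : 0 ≤ M.pathIntegral W s (s + t) ω :=
      pathIntegral_nonneg hW_nonneg (by linarith) ω
    rw [Real.exp_eq_exp_ℝ, NormedSpace.exp_eq_tsum_div,
      ENNReal.ofReal_tsum_of_nonneg (fun n => by positivity)
        (NormedSpace.expSeries_div_summable _)]
  simp_rw [exp_eq_tsum]
  rw [lintegral_tsum fun n =>
      (((measurable_pathIntegral hW _ _).pow_const n).div_const _).ennreal_ofReal.aemeasurable,
    lintegral_tsum (f := fun n ω => M.dyson W n t (M.X s ω)) fun n => ((measurable_dyson hW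
      n).comp (measurable_const.prodMk (M.measurable_eval s))).aemeasurable]
  refine tsum_congr fun n => ?_
  simpa using lintegral_mul_pathIntegral_pow_div_factorial (M := M) hW hB hW_nonneg n x s ht
    (g := fun _ => 1) measurable_const

/-- The Feynman-Kac semigroup applied to the constant function `1`:
`u_t(x) = 𝔼_x [exp ∫₀ᵗ W (X_s) ds]`. -/
noncomputable def feynmanKac (M : MarkovProcess E Ω) (W : E → ℝ) (t : ℝ) (x : E) : ℝ :=
  ∫ ω, Real.exp (M.pathIntegral W 0 t ω) ∂(M.law x)

theorem exp_pathIntegral_le (hB : ∀ x, |W x| ≤ B) (a b : ℝ) (ω : Ω) :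
    Real.exp (M.pathIntegral W a b ω) ≤ Real.exp (B * |b - a|) :=
  Real.exp_le_exp.mpr ((le_abs_self _).trans (abs_pathIntegral_le hB a b ω))

theorem integrable_exp_pathIntegral (hW : Measurable W) (hB : ∀ x, |W x| ≤ B) (a b : ℝ)
    (P : Measure Ω) [IsFiniteMeasure P] :
    Integrable (fun ω => Real.exp (M.pathIntegral W a b ω)) P :=
  Integrable.of_bound (measurable_pathIntegral hW a b).exp.aestronglyMeasurable _
    (Eventually.of_forall fun ω =>
      (Real.norm_of_nonneg (Real.exp_pos _).le).trans_le (exp_pathIntegral_le hB a b ω))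

theorem feynmanKac_nonneg (t : ℝ) (x : E) : 0 ≤ M.feynmanKac W t x :=
  integral_nonneg fun _ => (Real.exp_pos _).le

theorem feynmanKac_le (hB : ∀ x, |W x| ≤ B) (t : ℝ) (x : E) :
    M.feynmanKac W t x ≤ Real.exp (B * |t|) := by
  have h_bound := norm_integral_le_of_norm_le_const (μ := M.law x) (Eventually.of_forall fun ω =>
    (Real.norm_of_nonneg (Real.exp_pos _).le).trans_le (exp_pathIntegral_le (M := M) hB 0 t ω))
  rw [probReal_univ, mul_one, sub_zero] at h_bound
  exact (le_abs_self _).trans h_bound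

theorem measurable_feynmanKac (hW : Measurable W) (t : ℝ) : Measurable (M.feynmanKac W t) :=
  (StronglyMeasurable.integral_kernel
    (measurable_pathIntegral (M := M) hW 0 t).exp.stronglyMeasurable).measurable

theorem feynmanKac_add_const (hW : Measurable W) (hB : ∀ x, |W x| ≤ B) (c t : ℝ) :
    M.feynmanKac (fun x => W x + c) t = Real.exp (c * t) • M.feynmanKac W t := by
  ext x
  simp only [feynmanKac, pathIntegral_add_const hW hB, sub_zero, Real.exp_add,
    integral_mul_const, Pi.smul_apply, smul_eq_mul]
  exact mul_comm _ _

theorem semigroup_feynmanKac_of_nonneg (hW : Measurable W) (hB : ∀ x, |W x| ≤ B)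
    (hW_nonneg : ∀ x, 0 ≤ W x) (s : ℝ≥0) {t : ℝ} (ht : 0 ≤ t) (x : E) :
    M.semigroup s (M.feynmanKac W t) x =
      ∫ ω, Real.exp (M.pathIntegral W s (s + t) ω) ∂(M.law x) := by
  have feynmanKac_eq_tsum (y : E) :
      ENNReal.ofReal (M.feynmanKac W t y) = ∑' n, M.dyson W n t y := by
    have h_start : ∀ᵐ ω ∂(M.law y), ∑' n, M.dyson W n t (M.X 0 ω) = ∑' n, M.dyson W n t y :=
      (M.start y).mono fun ω hω => by simp only [hω]
    have h_exp := lintegral_exp_pathIntegral (M := M) hW hB hW_nonneg y 0 ht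
    rw [lintegral_congr_ae h_start, lintegral_const, measure_univ, mul_one, NNReal.coe_zero,
      zero_add] at h_exp
    rw [← h_exp, feynmanKac, ofReal_integral_eq_lintegral_ofReal
      (integrable_exp_pathIntegral hW hB 0 t _) (Eventually.of_forall fun _ => (Real.exp_pos _).le)]
  rw [semigroup, integral_eq_lintegral_of_nonneg_ae
      (Eventually.of_forall fun y => feynmanKac_nonneg t y)
      (measurable_feynmanKac hW t).aestronglyMeasurable,
    integral_eq_lintegral_of_nonneg_ae (Eventually.of_forall fun _ => (Real.exp_pos _).le)
      (measurable_pathIntegral hW _ _).exp.aestronglyMeasurable,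
    lintegral_exp_pathIntegral hW hB hW_nonneg x s ht,
    M.lintegral_transition _ _ (measurable_feynmanKac hW t).ennreal_ofReal]
  simp_rw [feynmanKac_eq_tsum]

theorem semigroup_feynmanKac (hW : Measurable W) (hB : ∀ x, |W x| ≤ B) (s : ℝ≥0) {t : ℝ}
    (ht : 0 ≤ t) (x : E) :
    M.semigroup s (M.feynmanKac W t) x =
      ∫ ω, Real.exp (M.pathIntegral W s (s + t) ω) ∂(M.law x) := by
  have h_nonneg (y : E) : 0 ≤ W y + B := by linarith [neg_le_of_abs_le (hB y)]
  have h_bound (y : E) : |W y + B| ≤ B + B := by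
    rw [abs_of_nonneg (h_nonneg y)]
    linarith [le_of_abs_le (hB y)]
  have h_shift := semigroup_feynmanKac_of_nonneg (M := M) (hW.add_const B) h_bound h_nonneg s ht x
  simp only [feynmanKac_add_const hW hB, pathIntegral_add_const hW hB, Real.exp_add,
    integral_mul_const, semigroup, Pi.smul_apply, smul_eq_mul, integral_const_mul,
    add_sub_cancel_left] at h_shift
  exact mul_left_cancel₀ (Real.exp_pos _).ne' (h_shift.trans (mul_comm _ _))

end MarkovProcess

theorem tendsto_lintegral_enorm_translate_sub {w : ℝ → ℝ} (hw : Integrable w) :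
    Tendsto (fun h : ℝ => ∫⁻ s, ‖w (s + h) - w s‖ₑ) (𝓝 0) (𝓝 0) := by
  have hw_memLp : MemLp w 1 := memLp_one_iff_integrable.mpr hw
  let τ (h : ℝ) : C(ℝ, ℝ) := ⟨fun s => s + h, by fun_prop⟩
  have hτ (h : ℝ) : MeasurePreserving (τ h) := measurePreserving_add_right volume h
  have hτ_cont : Continuous τ := ContinuousMap.continuous_of_continuous_uncurry _ (by
    change Continuous fun p : ℝ × ℝ => p.2 + p.1
    fun_prop)
  have h_lim := ((continuous_const (y := hw_memLp.toLp w)).compMeasurePreservingLp hτ_cont hτ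
    ENNReal.one_ne_top).tendsto 0 |>.edist
      (tendsto_const_nhds (x := Lp.compMeasurePreserving (τ 0) (hτ 0) (hw_memLp.toLp w)))
  rw [edist_self] at h_lim
  refine h_lim.congr fun h => ?_
  rw [Lp.toLp_compMeasurePreserving hw_memLp (hτ h),
    Lp.toLp_compMeasurePreserving hw_memLp (hτ 0), Lp.edist_toLp_toLp,
    eLpNorm_one_eq_lintegral_enorm]
  simp [τ]

theorem tendsto_setLIntegral_enorm_translate_sub {w : ℝ → ℝ} {a b : ℝ}
    (hw : LocallyIntegrable w) :
    Tendsto (fun h : ℝ => ∫⁻ s in Ioc a b, ‖w (s + h) - w s‖ₑ) (𝓝[>] 0) (𝓝 0) := by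
  have h_int : Integrable ((Ioc a (b + 1)).indicator w) :=
    (integrable_indicator_iff measurableSet_Ioc).mpr
      ((hw.integrableOn_isCompact isCompact_Icc).mono_set Ioc_subset_Icc_self)
  refine tendsto_of_tendsto_of_tendsto_of_le_of_le' tendsto_const_nhds
    ((tendsto_lintegral_enorm_translate_sub h_int).mono_left nhdsWithin_le_nhds)
    (Eventually.of_forall fun _ => zero_le) ?_
  filter_upwards [Ioo_mem_nhdsGT (zero_lt_one' ℝ)] with h hh
  refine le_trans (le_of_eq ?_) (setLIntegral_le_lintegral (Ioc a b) _)
  refine setLIntegral_congr_fun measurableSet_Ioc fun s hs => ?_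
  have hs_mem : s ∈ Ioc a (b + 1) := ⟨hs.1, by linarith [hs.2]⟩
  have hsh_mem : s + h ∈ Ioc a (b + 1) := ⟨by linarith [hs.1, hh.1], by linarith [hs.2, hh.2]⟩
  simp only [indicator_of_mem hs_mem, indicator_of_mem hsh_mem]

theorem enorm_integral_div_sub_le {w : ℝ → ℝ} {t h : ℝ} (hh : 0 < h)
    (hw : IntervalIntegrable w volume t (t + h)) (c : ℝ) :
    ‖(∫ r in t..t + h, w r) / h - c‖ₑ ≤
      ENNReal.ofReal h⁻¹ * ∫⁻ r in Ioc t (t + h), ‖w r - c‖ₑ := by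
  have h_eq : (∫ r in t..t + h, w r) / h - c = h⁻¹ * ∫ r in Ioc t (t + h), (w r - c) := by
    rw [← intervalIntegral.integral_of_le (by linarith),
      intervalIntegral.integral_sub hw intervalIntegrable_const, intervalIntegral.integral_const,
      add_sub_cancel_left, smul_eq_mul]
    field_simp
  rw [h_eq, enorm_mul, Real.enorm_of_nonneg (inv_nonneg.mpr hh.le)]
  gcongr
  exact enorm_integral_le_lintegral_enorm _

theorem tendsto_eLpNorm_two_of_tendsto_lintegral_enorm {α ι : Type*} [MeasurableSpace α]
    {μ : Measure α} {l : Filter ι} {f : ι → α → ℝ} {K : ℝ} (hK : ∀ i x, |f i x| ≤ K)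
    (hf : Tendsto (fun i => ∫⁻ x, ‖f i x‖ₑ ∂μ) l (𝓝 0)) :
    Tendsto (fun i => eLpNorm (f i) 2 μ) l (𝓝 0) := by
  have h_sq (i : ι) : eLpNorm (f i) 2 μ ≤
      (ENNReal.ofReal K * ∫⁻ x, ‖f i x‖ₑ ∂μ) ^ (2⁻¹ : ℝ) := by
    rw [eLpNorm_eq_lintegral_rpow_enorm_toReal two_ne_zero ENNReal.ofNat_ne_top,
      ← lintegral_const_mul' _ _ ENNReal.ofReal_ne_top]
    simp only [ENNReal.toReal_ofNat, ENNReal.rpow_ofNat, one_div]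
    gcongr with x
    rw [sq]
    gcongr
    rw [← ofReal_norm]
    exact ENNReal.ofReal_le_ofReal (hK i x)
  have h_lim := (ENNReal.Tendsto.const_mul hf (Or.inr ENNReal.ofReal_ne_top)
    (a := ENNReal.ofReal K)).ennrpow_const 2⁻¹
  rw [mul_zero, ENNReal.zero_rpow_of_pos (by norm_num)] at h_lim
  exact tendsto_of_tendsto_of_tendsto_of_le_of_le tendsto_const_nhds h_lim
    (fun _ => zero_le) h_sq

namespace MarkovProcess

variable {E Ω : Type*} [MeasurableSpace E] [MeasurableSpace Ω] {M : MarkovProcess E Ω}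
  {μ : Measure E} {W : E → ℝ} {B : ℝ}

theorem lintegral_initLaw (ν : Measure E) {Y : Ω → ℝ≥0∞} (hY : Measurable Y) :
    ∫⁻ ω, Y ω ∂(M.initLaw ν) = ∫⁻ x, ∫⁻ ω, Y ω ∂(M.law x) ∂ν :=
  Measure.lintegral_bind M.law.aemeasurable hY.aemeasurable

instance (ν : Measure E) [IsProbabilityMeasure ν] : IsProbabilityMeasure (M.initLaw ν) :=
  inferInstanceAs (IsProbabilityMeasure (ν.bind M.law))

theorem IsInvariant.map_eval (hμ : M.IsInvariant μ) (t : ℝ≥0) :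
    (M.initLaw μ).map (M.X t) = μ := by
  rw [initLaw, Measure.map_comp _ _ (M.measurable_eval t)]
  exact hμ t

theorem IsInvariant.map_eval_prodMk_eval_add [IsProbabilityMeasure μ] (hμ : M.IsInvariant μ)
    (s h : ℝ≥0) :
    (M.initLaw μ).map (fun ω => (M.X s ω, M.X (s + h) ω)) = μ ⊗ₘ M.transition h := by
  have h_pair : Measurable fun ω => (M.X s ω, M.X (s + h) ω) :=
    (M.measurable_eval s).prodMk (M.measurable_eval _)
  have : IsProbabilityMeasure ((M.initLaw μ).map fun ω => (M.X s ω, M.X (s + h) ω)) :=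
    Measure.isProbabilityMeasure_map h_pair.aemeasurable
  refine Measure.ext_prod fun {A C} hA hC => ?_
  have hA' : MeasurableSet (M.X s ⁻¹' A) := M.measurable_eval s hA
  have h_kernel : Measurable fun y => M.transition h y C := Kernel.measurable_coe _ hC
  have h_kernel_eval : Measurable fun ω => M.transition h (M.X s ω) C :=
    h_kernel.comp (M.measurable_eval s)
  have h_markov (x : E) : M.law x (M.X s ⁻¹' A ∩ M.X (s + h) ⁻¹' C) =
      ∫⁻ ω in M.X s ⁻¹' A, M.transition h (M.X s ω) C ∂(M.law x) := by
    simp only [transition, Kernel.map_apply' _ (M.measurable_eval h) _ hC]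
    exact M.markov x s h _ (M.measurable_eval_past s hA) C hC
  rw [Measure.map_apply h_pair (hA.prod hC), mk_preimage_prod, initLaw,
    Measure.bind_apply (hA'.inter (M.measurable_eval _ hC)) M.law.aemeasurable,
    Measure.compProd_apply_prod hA hC]
  simp only [h_markov, ← lintegral_indicator hA']
  rw [← lintegral_initLaw μ (h_kernel_eval.indicator hA'),
    lintegral_indicator hA', ← setLIntegral_map hA h_kernel (M.measurable_eval s), hμ.map_eval]

theorem IsInvariant.lintegral_enorm_sub [IsProbabilityMeasure μ] (hμ : M.IsInvariant μ)
    (hW : Measurable W) {s r : ℝ} (hs : 0 ≤ s) (hsr : s ≤ r) :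
    ∫⁻ ω, ‖W (M.X r.toNNReal ω) - W (M.X s.toNNReal ω)‖ₑ ∂(M.initLaw μ) =
      ∫⁻ p, ‖W p.2 - W p.1‖ₑ ∂(μ ⊗ₘ M.transition (r - s).toNNReal) := by
  have h_time : r.toNNReal = s.toNNReal + (r - s).toNNReal := by
    rw [← Real.toNNReal_add hs (sub_nonneg.mpr hsr), add_sub_cancel]
  rw [← hμ.map_eval_prodMk_eval_add s.toNNReal, lintegral_map (by fun_prop)
    ((M.measurable_eval _).prodMk (M.measurable_eval _)), h_time]

/- Paths are only jointly measurable, so continuity in mean at time `0` is obtained by averaging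
over the starting time in `[0, 1]`, which stationarity permits. -/
theorem IsInvariant.tendsto_lintegral_enorm_sub [IsProbabilityMeasure μ] (hμ : M.IsInvariant μ)
    (hW : Measurable W) (hB : ∀ x, |W x| ≤ B) :
    Tendsto (fun h : ℝ => ∫⁻ p, ‖W p.2 - W p.1‖ₑ ∂(μ ⊗ₘ M.transition h.toNNReal))
      (𝓝[>] 0) (𝓝 0) := by
  let D (h : ℝ) (s : ℝ) (ω : Ω) : ℝ≥0∞ :=
    ‖W (M.X (s + h).toNNReal ω) - W (M.X s.toNNReal ω)‖ₑ
  have hD (h : ℝ) : Measurable fun p : ℝ × Ω => D h p.1 p.2 :=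
    (((M.measurable_path hW).comp (f := fun p : ℝ × Ω => (p.1 + h, p.2)) (by fun_prop)).sub
      (M.measurable_path hW)).enorm
  have hD_le (h : ℝ) (ω : Ω) : ∫⁻ s in Ioc (0 : ℝ) 1, D h s ω ≤ ENNReal.ofReal (B + B) := by
    refine (setLIntegral_mono measurable_const fun s _ => ?_).trans
      (by simp : ∫⁻ _ in Ioc (0 : ℝ) 1, ENNReal.ofReal (B + B) ≤ _)
    exact (ofReal_norm _).symm.trans_le
      (ENNReal.ofReal_le_ofReal ((norm_sub_le _ _).trans (add_le_add (hB _) (hB _))))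
  have h_lim : Tendsto (fun h => ∫⁻ ω, (∫⁻ s in Ioc (0 : ℝ) 1, D h s ω) ∂(M.initLaw μ))
      (𝓝[>] 0) (𝓝 (∫⁻ _, 0 ∂(M.initLaw μ))) :=
    tendsto_lintegral_filter_of_dominated_convergence (fun _ => ENNReal.ofReal (B + B))
      (Eventually.of_forall fun h => (hD h).lintegral_prod_left')
      (Eventually.of_forall fun h => Eventually.of_forall (hD_le h))
      (by rw [lintegral_const, measure_univ, mul_one]; exact ENNReal.ofReal_ne_top)
      (Eventually.of_forall fun ω => tendsto_setLIntegral_enorm_translate_sub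
        (locallyIntegrable_path hW hB ω))
  rw [lintegral_zero] at h_lim
  refine h_lim.congr' ?_
  filter_upwards [self_mem_nhdsWithin] with h (hh : 0 < h)
  have h_stationary (s : ℝ) (hs : s ∈ Ioc (0 : ℝ) 1) : ∫⁻ ω, D h s ω ∂(M.initLaw μ) =
      ∫⁻ p, ‖W p.2 - W p.1‖ₑ ∂(μ ⊗ₘ M.transition h.toNNReal) := by
    have h_law := hμ.lintegral_enorm_sub (M := M) hW hs.1.le (le_add_of_nonneg_right hh.le)
    rwa [add_sub_cancel_left] at h_law
  rw [← lintegral_lintegral_swap (hD h).aemeasurable,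
    setLIntegral_congr_fun measurableSet_Ioc h_stationary, setLIntegral_const, Real.volume_Ioc,
    sub_zero, ENNReal.ofReal_one, mul_one]

theorem IsInvariant.tendsto_lintegral_enorm_pathIntegral_div_sub [IsProbabilityMeasure μ]
    (hμ : M.IsInvariant μ) (hW : Measurable W) (hB : ∀ x, |W x| ≤ B) {t : ℝ} (ht : 0 ≤ t) :
    Tendsto (fun h : ℝ => ∫⁻ ω, ‖M.pathIntegral W t (t + h) ω / h - W (M.X t.toNNReal ω)‖ₑ
      ∂(M.initLaw μ)) (𝓝[>] 0) (𝓝 0) := by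
  rw [ENNReal.tendsto_nhds_zero]
  intro ε hε
  obtain ⟨δ, hδ, h_small⟩ := mem_nhdsGT_iff_exists_Ioc_subset.mp
    (ENNReal.tendsto_nhds_zero.mp (hμ.tendsto_lintegral_enorm_sub hW hB) ε hε)
  filter_upwards [Ioc_mem_nhdsGT hδ] with h hh
  let D (ω : Ω) (r : ℝ) : ℝ≥0∞ := ‖W (M.X r.toNNReal ω) - W (M.X t.toNNReal ω)‖ₑ
  have hD : Measurable fun p : Ω × ℝ => D p.1 p.2 :=
    (((M.measurable_path hW).comp measurable_swap).sub
      ((hW.comp (M.measurable_eval _)).comp measurable_fst)).enorm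
  calc ∫⁻ ω, ‖M.pathIntegral W t (t + h) ω / h - W (M.X t.toNNReal ω)‖ₑ ∂(M.initLaw μ)
      ≤ ∫⁻ ω, ENNReal.ofReal h⁻¹ * (∫⁻ r in Ioc t (t + h), D ω r) ∂(M.initLaw μ) :=
        lintegral_mono fun ω =>
          enorm_integral_div_sub_le hh.1 (intervalIntegrable_path hW hB ω _ _) _
    _ = ENNReal.ofReal h⁻¹ * ∫⁻ r in Ioc t (t + h), (∫⁻ ω, D ω r ∂(M.initLaw μ)) := by
        rw [lintegral_const_mul _ hD.lintegral_prod_right',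
          lintegral_lintegral_swap hD.aemeasurable]
    _ ≤ ENNReal.ofReal h⁻¹ * ∫⁻ _ in Ioc t (t + h), ε := by
        gcongr ENNReal.ofReal h⁻¹ * ?_
        refine setLIntegral_mono measurable_const fun r hr => ?_
        rw [hμ.lintegral_enorm_sub hW ht hr.1.le]
        exact h_small ⟨sub_pos.mpr hr.1, by linarith [hr.2, hh.2]⟩
    _ = ε := by
        rw [setLIntegral_const, Real.volume_Ioc, add_sub_cancel_left, mul_comm ε, ← mul_assoc,
          ← ENNReal.ofReal_mul (inv_nonneg.mpr hh.1.le), inv_mul_cancel₀ hh.1.ne',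
          ENNReal.ofReal_one, one_mul]

theorem IsInvariant.tendsto_eLpNorm_pathIntegral_div_sub [IsProbabilityMeasure μ]
    (hμ : M.IsInvariant μ) (hW : Measurable W) (hB : ∀ x, |W x| ≤ B) {t : ℝ} (ht : 0 ≤ t) :
    Tendsto (fun h : ℝ => eLpNorm (fun ω => M.pathIntegral W t (t + h) ω / h -
      W (M.X t.toNNReal ω)) 2 (M.initLaw μ)) (𝓝[>] 0) (𝓝 0) := by
  refine tendsto_eLpNorm_two_of_tendsto_lintegral_enorm (K := B + B) (fun h ω => ?_)
    (hμ.tendsto_lintegral_enorm_pathIntegral_div_sub hW hB ht)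
  have h_avg : |M.pathIntegral W t (t + h) ω / h| ≤ B := by
    rw [abs_div]
    refine div_le_of_le_mul₀ (abs_nonneg h) ((abs_nonneg _).trans (hB (M.X 0 ω))) ?_
    simpa using abs_pathIntegral_le (M := M) hB t (t + h) ω
  exact (abs_sub _ _).trans (add_le_add h_avg (hB _))

end MarkovProcess

theorem eLpNorm_integral_kernel_le {α β : Type*} [MeasurableSpace α] [MeasurableSpace β]
    {κ : Kernel α β} [IsMarkovKernel κ] {μ : Measure α} {f : β → ℝ} (hf : Measurable f)
    {p : ℝ≥0} (hp : 1 ≤ p) :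
    eLpNorm (fun a => ∫ b, f b ∂(κ a)) p μ ≤ eLpNorm f p (μ.bind κ) := by
  have hp_ne : p ≠ 0 := (zero_lt_one.trans_le hp).ne'
  have h_jensen (a : α) : ‖∫ b, f b ∂(κ a)‖ₑ ≤ eLpNorm f p (κ a) := by
    refine (enorm_integral_le_lintegral_enorm f).trans ?_
    rw [← eLpNorm_one_eq_lintegral_enorm]
    exact eLpNorm_le_eLpNorm_of_exponent_le (mod_cast hp) hf.aestronglyMeasurable
  rw [← ENNReal.rpow_le_rpow_iff (NNReal.coe_pos.mpr (pos_iff_ne_zero.mpr hp_ne)),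
    eLpNorm_nnreal_pow_eq_lintegral hp_ne, eLpNorm_nnreal_pow_eq_lintegral hp_ne,
    Measure.lintegral_bind κ.aemeasurable (hf.enorm.pow_const _).aemeasurable]
  refine lintegral_mono fun a => ?_
  rw [← eLpNorm_nnreal_pow_eq_lintegral hp_ne]
  exact ENNReal.rpow_le_rpow (h_jensen a) p.2

theorem abs_exp_sub_one_div_sub_le {z h c : ℝ} (hz : |z| ≤ 1) (hh : 0 < h) :
    |(Real.exp z - 1) / h - c| ≤ z ^ 2 / h + |z / h - c| := by
  calc |(Real.exp z - 1) / h - c| = |(Real.exp z - 1 - z) / h + (z / h - c)| := by ring_nf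
    _ ≤ |(Real.exp z - 1 - z) / h| + |z / h - c| := abs_add_le _ _
    _ ≤ z ^ 2 / h + |z / h - c| := by
        rw [abs_div, abs_of_pos hh]
        gcongr
        exact Real.abs_exp_sub_one_sub_id_le hz

section ExpDifferenceQuotient

variable {Ω : Type*} [MeasurableSpace Ω] {Z : ℝ → Ω → ℝ} {U c : Ω → ℝ} {K C : ℝ}

theorem eLpNorm_mul_exp_sub_one_div_sub_le {P : Measure Ω} {p : ℝ≥0∞}
    (hp : 1 ≤ p) {h : ℝ} (hZ : Measurable (Z h)) (hc : Measurable c) (hU : ∀ ω, |U ω| ≤ K)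
    (hh : 0 < h) (hCh : C * h ≤ 1) (hZ_le : ∀ ω, |Z h ω| ≤ C * h) :
    eLpNorm (fun ω => U ω * ((Real.exp (Z h ω) - 1) / h - c ω)) p P ≤
      ENNReal.ofReal K * (P univ ^ p.toReal⁻¹ * ENNReal.ofReal (C ^ 2 * h) +
        eLpNorm (fun ω => Z h ω / h - c ω) p P) := by
  have h_quot : Measurable fun ω => Z h ω / h - c ω := (hZ.div_const h).sub hc
  have h_bound (ω : Ω) : ‖U ω * ((Real.exp (Z h ω) - 1) / h - c ω)‖ ≤
      K * ‖C ^ 2 * h + ‖Z h ω / h - c ω‖‖ := by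
    rw [norm_mul, Real.norm_of_nonneg (by positivity : 0 ≤ C ^ 2 * h + ‖Z h ω / h - c ω‖)]
    gcongr
    · exact (abs_nonneg _).trans (hU ω)
    · exact hU ω
    · refine (abs_exp_sub_one_div_sub_le ((hZ_le ω).trans hCh) hh).trans ?_
      gcongr
      · rw [div_le_iff₀ hh, ← sq_abs]
        calc |Z h ω| ^ 2 ≤ (C * h) ^ 2 := by gcongr; exact hZ_le ω
          _ = C ^ 2 * h * h := by ring
      · exact le_rfl
  refine (eLpNorm_le_mul_eLpNorm_of_ae_le_mul (Eventually.of_forall h_bound) p).trans ?_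
  gcongr
  refine (eLpNorm_add_le aestronglyMeasurable_const h_quot.norm.aestronglyMeasurable hp).trans ?_
  rw [eLpNorm_norm]
  gcongr
  exact eLpNorm_le_of_ae_bound (Eventually.of_forall fun _ =>
    (Real.norm_of_nonneg (by positivity)).le)

theorem tendsto_eLpNorm_mul_exp_sub_one_div_sub {P : Measure Ω} [IsFiniteMeasure P] {p : ℝ≥0∞}
    (hp : 1 ≤ p) (hZ : ∀ h, Measurable (Z h)) (hc : Measurable c) (hU : ∀ ω, |U ω| ≤ K)
    (hZ_le : ∀ h, 0 ≤ h → ∀ ω, |Z h ω| ≤ C * h)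
    (h_lim : Tendsto (fun h => eLpNorm (fun ω => Z h ω / h - c ω) p P) (𝓝[>] 0) (𝓝 0)) :
    Tendsto (fun h => eLpNorm (fun ω => U ω * ((Real.exp (Z h ω) - 1) / h - c ω)) p P)
      (𝓝[>] 0) (𝓝 0) := by
  have h_ofReal : Tendsto (fun h => ENNReal.ofReal (C ^ 2 * h)) (𝓝[>] 0) (𝓝 0) := by
    have h_cont : Continuous fun h => ENNReal.ofReal (C ^ 2 * h) :=
      ENNReal.continuous_ofReal.comp (continuous_const_mul _)
    simpa using (h_cont.tendsto 0).mono_left nhdsWithin_le_nhds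
  have h_bound : Tendsto (fun h => ENNReal.ofReal K *
      (P univ ^ p.toReal⁻¹ * ENNReal.ofReal (C ^ 2 * h) +
        eLpNorm (fun ω => Z h ω / h - c ω) p P)) (𝓝[>] 0) (𝓝 0) := by
    have h_mass : P univ ^ p.toReal⁻¹ ≠ ∞ := by finiteness
    simpa using ENNReal.Tendsto.const_mul
      ((ENNReal.Tendsto.const_mul h_ofReal (Or.inr h_mass)).add h_lim)
      (Or.inr ENNReal.ofReal_ne_top)
  have h_small : ∀ᶠ h in 𝓝[>] (0 : ℝ), C * h ≤ 1 := by
    have h_tendsto : Tendsto (fun h => C * h) (𝓝[>] 0) (𝓝 (C * 0)) :=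
      ((continuous_const_mul C).tendsto 0).mono_left nhdsWithin_le_nhds
    rw [mul_zero] at h_tendsto
    exact h_tendsto.eventually_le_const one_pos
  refine tendsto_of_tendsto_of_tendsto_of_le_of_le' tendsto_const_nhds h_bound
    (Eventually.of_forall fun _ => zero_le) ?_
  filter_upwards [self_mem_nhdsWithin, h_small] with h (hh : 0 < h) hCh
  exact eLpNorm_mul_exp_sub_one_div_sub_le hp (hZ h) hc hU hh hCh (hZ_le h hh.le)

theorem tendsto_eLpNorm_integral_mul_exp_sub_div_sub {α : Type*} [MeasurableSpace α]
    {κ : Kernel α Ω} [IsMarkovKernel κ] {μ : Measure α} [IsFiniteMeasure μ] {p : ℝ≥0} (hp : 1 ≤ p)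
    (hZ : ∀ h, Measurable (Z h)) (hU_meas : Measurable U) (hU : ∀ ω, |U ω| ≤ K)
    (hc_meas : Measurable c) {D : ℝ} (hc : ∀ ω, |c ω| ≤ D)
    (hZ_le : ∀ h, 0 ≤ h → ∀ ω, |Z h ω| ≤ C * h)
    (h_lim : Tendsto (fun h => eLpNorm (fun ω => Z h ω / h - c ω) p (μ.bind κ))
      (𝓝[>] 0) (𝓝 0)) :
    Tendsto (fun h => eLpNorm (fun a =>
      (∫ ω, U ω * Real.exp (Z h ω) ∂(κ a) - ∫ ω, U ω ∂(κ a)) / h - ∫ ω, U ω * c ω ∂(κ a)) p μ)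
      (𝓝[>] 0) (𝓝 0) := by
  refine tendsto_of_tendsto_of_tendsto_of_le_of_le' tendsto_const_nhds
    (tendsto_eLpNorm_mul_exp_sub_one_div_sub (mod_cast hp) hZ hc_meas hU hZ_le h_lim)
    (Eventually.of_forall fun _ => zero_le) ?_
  filter_upwards [self_mem_nhdsWithin] with h (hh : 0 < h)
  have hU_int (a : α) : Integrable U (κ a) :=
    .of_bound hU_meas.aestronglyMeasurable K (Eventually.of_forall hU)
  have h_exp_int (a : α) : Integrable (fun ω => U ω * Real.exp (Z h ω)) (κ a) :=
    (hU_int a).mul_bdd (c := Real.exp (C * h)) (hZ h).exp.aestronglyMeasurable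
      (Eventually.of_forall fun ω => by
        rw [Real.norm_of_nonneg (Real.exp_pos _).le, Real.exp_le_exp]
        exact (le_abs_self _).trans (hZ_le h hh.le ω))
  have hc_int (a : α) : Integrable (fun ω => U ω * c ω) (κ a) :=
    (hU_int a).mul_bdd hc_meas.aestronglyMeasurable (Eventually.of_forall hc)
  have h_eq (a : α) : (∫ ω, U ω * Real.exp (Z h ω) ∂(κ a) - ∫ ω, U ω ∂(κ a)) / h -
      ∫ ω, U ω * c ω ∂(κ a) =
        ∫ ω, U ω * ((Real.exp (Z h ω) - 1) / h - c ω) ∂(κ a) := by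
    rw [← integral_sub (h_exp_int a) (hU_int a), ← integral_div,
      ← integral_sub (f := fun ω => (U ω * Real.exp (Z h ω) - U ω) / h)
        (((h_exp_int a).sub (hU_int a)).div_const h) (hc_int a)]
    congr with ω
    ring
  simp only [h_eq]
  exact eLpNorm_integral_kernel_le
    (hU_meas.mul ((((hZ h).exp.sub_const 1).div_const h).sub hc_meas)) hp

end ExpDifferenceQuotient

namespace MarkovProcess

variable {E Ω : Type*} [MeasurableSpace E] [MeasurableSpace Ω] {M : MarkovProcess E Ω}
  {μ : Measure E} {W : E → ℝ} {B : ℝ}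

/-- The time derivative `𝔼_x [W (X_t) exp ∫₀ᵗ W (X_s) ds]` of the Feynman-Kac function. -/
noncomputable def feynmanKacDeriv (M : MarkovProcess E Ω) (W : E → ℝ) (t : ℝ) (x : E) : ℝ :=
  ∫ ω, Real.exp (M.pathIntegral W 0 t ω) * W (M.X t.toNNReal ω) ∂(M.law x)

theorem measurable_feynmanKacDeriv (hW : Measurable W) (t : ℝ) :
    Measurable (M.feynmanKacDeriv W t) :=
  (((measurable_pathIntegral hW 0 t).exp.mul
    (hW.comp (M.measurable_eval _))).stronglyMeasurable.integral_kernel (κ := M.law)).measurable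

theorem abs_feynmanKacDeriv_le (hB : ∀ x, |W x| ≤ B) (t : ℝ) (x : E) :
    |M.feynmanKacDeriv W t x| ≤ Real.exp (B * |t|) * B := by
  suffices h_le : ∀ ω, ‖Real.exp (M.pathIntegral W 0 t ω) * W (M.X t.toNNReal ω)‖ ≤
      Real.exp (B * |t|) * B by
    simpa [feynmanKacDeriv] using
      norm_integral_le_of_norm_le_const (μ := M.law x) (Eventually.of_forall h_le)
  intro ω
  rw [norm_mul, Real.norm_of_nonneg (Real.exp_pos _).le]
  gcongr
  · simpa using exp_pathIntegral_le (M := M) hB 0 t ω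
  · exact hB _

theorem abs_feynmanKac_le (hB : ∀ x, |W x| ≤ B) (t : ℝ) (x : E) :
    |M.feynmanKac W t x| ≤ Real.exp (B * |t|) := by
  rw [abs_of_nonneg (feynmanKac_nonneg t x)]
  exact feynmanKac_le hB t x

theorem memLp_feynmanKac [IsFiniteMeasure μ] (hW : Measurable W) (hB : ∀ x, |W x| ≤ B) (t : ℝ)
    (p : ℝ≥0∞) : MemLp (M.feynmanKac W t) p μ :=
  .of_bound (measurable_feynmanKac hW t).aestronglyMeasurable _
    (Eventually.of_forall (abs_feynmanKac_le hB t))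

theorem memLp_feynmanKacDeriv [IsFiniteMeasure μ] (hW : Measurable W) (hB : ∀ x, |W x| ≤ B)
    (t : ℝ) (p : ℝ≥0∞) : MemLp (M.feynmanKacDeriv W t) p μ :=
  .of_bound (measurable_feynmanKacDeriv hW t).aestronglyMeasurable _
    (Eventually.of_forall (abs_feynmanKacDeriv_le hB t))

theorem pathIntegral_add_adjacent (hW : Measurable W) (hB : ∀ x, |W x| ≤ B) (a b c : ℝ) (ω : Ω) :
    M.pathIntegral W a b ω + M.pathIntegral W b c ω = M.pathIntegral W a c ω :=
  intervalIntegral.integral_add_adjacent_intervals (intervalIntegrable_path hW hB ω a b)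
    (intervalIntegrable_path hW hB ω b c)

theorem abs_pathIntegral_add_le (hB : ∀ x, |W x| ≤ B) (t : ℝ) {h : ℝ} (hh : 0 ≤ h) (ω : Ω) :
    |M.pathIntegral W t (t + h) ω| ≤ B * h := by
  simpa [abs_of_nonneg hh] using abs_pathIntegral_le (M := M) hB t (t + h) ω

theorem IsInvariant.tendsto_eLpNorm_feynmanKac_slope_sub [IsProbabilityMeasure μ]
    (hμ : M.IsInvariant μ) (hW : Measurable W) (hB : ∀ x, |W x| ≤ B) {t : ℝ} (ht : 0 ≤ t) :
    Tendsto (fun h : ℝ => eLpNorm (fun x =>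
      (M.feynmanKac W (t + h) x - M.feynmanKac W t x) / h - M.feynmanKacDeriv W t x) 2 μ)
      (𝓝[>] 0) (𝓝 0) := by
  refine (tendsto_eLpNorm_integral_mul_exp_sub_div_sub (κ := M.law) (p := 2)
    (U := fun ω => Real.exp (M.pathIntegral W 0 t ω)) one_le_two
    (fun h => measurable_pathIntegral hW t (t + h)) (measurable_pathIntegral hW 0 t).exp
    (fun ω => (Real.abs_exp _).trans_le (exp_pathIntegral_le hB 0 t ω))
    (hW.comp (M.measurable_eval t.toNNReal)) (fun _ => hB _)
    (fun _ hh ω => abs_pathIntegral_add_le hB t hh ω)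
    (hμ.tendsto_eLpNorm_pathIntegral_div_sub hW hB ht)).congr fun h => ?_
  simp only [feynmanKac, feynmanKacDeriv, ← Real.exp_add, pathIntegral_add_adjacent hW hB,
    Function.comp_apply, ENNReal.coe_ofNat]

theorem IsInvariant.tendsto_eLpNorm_pathIntegral_sub_div_sub [IsProbabilityMeasure μ]
    (hμ : M.IsInvariant μ) (hW : Measurable W) (hB : ∀ x, |W x| ≤ B) {t : ℝ} (ht : 0 ≤ t) :
    Tendsto (fun h : ℝ => eLpNorm (fun ω =>
      (M.pathIntegral W t (t + h) ω - M.pathIntegral W 0 (0 + h) ω) / h -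
        (W (M.X t.toNNReal ω) - W (M.X 0 ω))) 2 (M.initLaw μ)) (𝓝[>] 0) (𝓝 0) := by
  have h_lim := (hμ.tendsto_eLpNorm_pathIntegral_div_sub hW hB ht).add
    (hμ.tendsto_eLpNorm_pathIntegral_div_sub hW hB le_rfl)
  rw [add_zero] at h_lim
  refine tendsto_of_tendsto_of_tendsto_of_le_of_le tendsto_const_nhds h_lim
    (fun _ => zero_le) fun h => ?_
  have h_meas (s : ℝ) : AEStronglyMeasurable (fun ω =>
      M.pathIntegral W s (s + h) ω / h - W (M.X s.toNNReal ω)) (M.initLaw μ) :=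
    (((measurable_pathIntegral hW s (s + h)).div_const h).sub
      (hW.comp (M.measurable_eval _))).aestronglyMeasurable
  refine le_trans (le_of_eq ?_) (eLpNorm_sub_le (h_meas t) (h_meas 0) one_le_two)
  congr with ω
  simp only [Real.toNNReal_zero, Pi.sub_apply]
  ring

theorem integral_exp_pathIntegral_mul_sub_start (hW : Measurable W) (hB : ∀ x, |W x| ≤ B)
    (t : ℝ) (x : E) :
    ∫ ω, Real.exp (M.pathIntegral W 0 t ω) * (W (M.X t.toNNReal ω) - W (M.X 0 ω)) ∂(M.law x) =
      M.feynmanKacDeriv W t x - W x * M.feynmanKac W t x := by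
  have h_int (s : ℝ≥0) :
      Integrable (fun ω => Real.exp (M.pathIntegral W 0 t ω) * W (M.X s ω)) (M.law x) :=
    (integrable_exp_pathIntegral hW hB 0 t _).mul_bdd
      (hW.comp (M.measurable_eval s)).aestronglyMeasurable (Eventually.of_forall fun _ => hB _)
  simp only [mul_sub]
  rw [integral_sub (h_int _) (h_int _), feynmanKacDeriv, feynmanKac, ← integral_const_mul]
  congr 1
  refine integral_congr_ae ?_
  filter_upwards [M.start x] with ω hω
  rw [hω, mul_comm]

theorem IsInvariant.hasGenerator_feynmanKac [IsProbabilityMeasure μ] (hμ : M.IsInvariant μ)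
    (hW : Measurable W) (hB : ∀ x, |W x| ≤ B) {t : ℝ} (ht : 0 ≤ t) :
    M.HasGenerator μ (M.feynmanKac W t)
      (fun x => M.feynmanKacDeriv W t x - W x * M.feynmanKac W t x) := by
  have hW_memLp : MemLp W ∞ μ := memLp_top_of_bound hW.aestronglyMeasurable B
    (Eventually.of_forall hB)
  refine ⟨memLp_feynmanKac hW hB t 2,
    (memLp_feynmanKacDeriv hW hB t 2).sub ((memLp_feynmanKac hW hB t 2).mul hW_memLp), ?_⟩
  have h_lim := tendsto_eLpNorm_integral_mul_exp_sub_div_sub (κ := M.law) (p := 2)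
    (U := fun ω => Real.exp (M.pathIntegral W 0 t ω)) one_le_two
    (fun h => (measurable_pathIntegral hW t (t + h)).sub (measurable_pathIntegral hW 0 (0 + h)))
    (measurable_pathIntegral hW 0 t).exp
    (fun ω => (Real.abs_exp _).trans_le (exp_pathIntegral_le hB 0 t ω))
    ((hW.comp (M.measurable_eval t.toNNReal)).sub (hW.comp (M.measurable_eval 0)))
    (fun _ => (abs_sub _ _).trans (add_le_add (hB _) (hB _))) (C := B + B)
    (fun h hh ω => by
      rw [add_mul]
      exact (abs_sub _ _).trans (add_le_add (abs_pathIntegral_add_le hB t hh ω)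
        (abs_pathIntegral_add_le hB 0 hh ω)))
    (hμ.tendsto_eLpNorm_pathIntegral_sub_div_sub hW hB ht)
  have h_coe : Tendsto ((↑) : ℝ≥0 → ℝ) (𝓝[>] 0) (𝓝[>] 0) :=
    (NNReal.map_coe_nhdsGT 0).le
  refine (h_lim.comp h_coe).congr fun h => ?_
  have h_shift (ω : Ω) : Real.exp (M.pathIntegral W 0 t ω) *
      Real.exp (M.pathIntegral W t (t + h) ω - M.pathIntegral W 0 (0 + h) ω) =
        Real.exp (M.pathIntegral W h (h + t) ω) := by
    rw [← Real.exp_add, Real.exp_eq_exp, zero_add, add_comm (h : ℝ) t]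
    linear_combination pathIntegral_add_adjacent (M := M) hW hB 0 t (t + h) ω -
      pathIntegral_add_adjacent (M := M) hW hB 0 h (t + h) ω
  simp only [Function.comp_def, Pi.sub_apply, h_shift, semigroup_feynmanKac hW hB h ht,
    integral_exp_pathIntegral_mul_sub_start hW hB, feynmanKac, ENNReal.coe_ofNat]

end MarkovProcess

section DerivativeInL2

variable {α : Type*} [MeasurableSpace α] {μ : Measure α}

theorem norm_sq_toLp_eq_integral_sq {f : α → ℝ} (hf : MemLp f 2 μ) :
    ‖hf.toLp f‖ ^ 2 = ∫ x, f x ^ 2 ∂μ := by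
  rw [← real_inner_self_eq_norm_sq, L2.inner_def]
  refine integral_congr_ae (hf.coeFn_toLp.mono fun x hx => ?_)
  simp [hx, sq]

theorem inner_toLp_eq_integral_mul {f g : α → ℝ} (hf : MemLp f 2 μ) (hg : MemLp g 2 μ) :
    inner ℝ (hf.toLp f) (hg.toLp g) = ∫ x, f x * g x ∂μ := by
  rw [L2.inner_def]
  refine integral_congr_ae ?_
  filter_upwards [hf.coeFn_toLp, hg.coeFn_toLp] with x hfx hgx
  simp [hfx, hgx, mul_comm]

theorem hasDerivWithinAt_toLp {p : ℝ≥0∞} [Fact (1 ≤ p)] {u : ℝ → α → ℝ} {v : α → ℝ} {t : ℝ}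
    (hu : ∀ s, MemLp (u s) p μ) (hv : MemLp v p μ)
    (h_lim : Tendsto (fun h => eLpNorm (fun x => (u (t + h) x - u t x) / h - v x) p μ)
      (𝓝[>] 0) (𝓝 0)) :
    HasDerivWithinAt (fun s => (hu s).toLp (u s)) (hv.toLp v) (Ici t) t := by
  rw [← hasDerivWithinAt_Ioi_iff_Ici, hasDerivWithinAt_iff_tendsto_slope' self_notMem_Ioi,
    tendsto_iff_edist_tendsto_0, ← add_zero t, ← map_add_left_nhdsGT, tendsto_map'_iff]
  refine h_lim.congr fun h => ?_
  have h_slope : slope (fun s => (hu s).toLp (u s)) (t + 0) (t + h) =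
      (((hu (t + h)).sub (hu t)).const_smul h⁻¹).toLp (h⁻¹ • (u (t + h) - u t)) := by
    rw [MemLp.toLp_const_smul h⁻¹ ((hu (t + h)).sub (hu t)), MemLp.toLp_sub (hu (t + h)) (hu t),
      slope_def_module]
    simp only [add_zero, add_sub_cancel_left]
  rw [Function.comp_apply, h_slope, Lp.edist_toLp_toLp]
  congr with x
  simp [div_eq_inv_mul]

theorem hasDerivWithinAt_integral_sq {u : ℝ → α → ℝ} {v : α → ℝ} {t : ℝ}
    (hu : ∀ s, MemLp (u s) 2 μ) (hv : MemLp v 2 μ)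
    (h_lim : Tendsto (fun h => eLpNorm (fun x => (u (t + h) x - u t x) / h - v x) 2 μ)
      (𝓝[>] 0) (𝓝 0)) :
    HasDerivWithinAt (fun s => ∫ x, u s x ^ 2 ∂μ) (2 * ∫ x, u t x * v x ∂μ) (Ici t) t := by
  simpa only [norm_sq_toLp_eq_integral_sq, inner_toLp_eq_integral_mul] using
    (hasDerivWithinAt_toLp hu hv h_lim).norm_sq

end DerivativeInL2

theorem coe_integral_eq_lintegral_ofReal_sub {α : Type*} [MeasurableSpace α] {μ : Measure α}
    {f : α → ℝ} (hf : Integrable f μ) :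
    ((∫ x, f x ∂μ : ℝ) : EReal) =
      ((∫⁻ x, ENNReal.ofReal (f x) ∂μ : ℝ≥0∞) : EReal) -
        ((∫⁻ x, ENNReal.ofReal (-f x) ∂μ : ℝ≥0∞) : EReal) := by
  have h_neg : ∫⁻ x, ENNReal.ofReal (-f x) ∂μ ≠ ∞ := (Integrable.lintegral_lt_top hf.neg).ne
  rw [integral_eq_lintegral_pos_part_sub_lintegral_neg_part hf, EReal.coe_sub,
    EReal.coe_ennreal_toReal hf.lintegral_lt_top.ne, EReal.coe_ennreal_toReal h_neg]

theorem le_mul_exp_of_hasDerivWithinAt_le {φ φ' : ℝ → ℝ} {K T : ℝ}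
    (h_cont : ContinuousOn φ (Icc 0 T))
    (h_deriv : ∀ t ∈ Ico 0 T, HasDerivWithinAt φ (φ' t) (Ici t) t)
    (h_le : ∀ t ∈ Ico 0 T, φ' t ≤ K * φ t) {t : ℝ} (ht : t ∈ Icc 0 T) :
    φ t ≤ φ 0 * Real.exp (K * t) := by
  have h_gronwall := le_gronwallBound_of_liminf_deriv_right_le h_cont
    (fun s hs r hr => (h_deriv s hs).liminf_right_slope_le hr) le_rfl
    (fun s hs => (h_le s hs).trans_eq (add_zero _).symm) t ht
  rwa [gronwallBound_ε0, sub_zero] at h_gronwall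

namespace MarkovProcess

variable {E Ω : Type*} [MeasurableSpace E] [MeasurableSpace Ω] {M : MarkovProcess E Ω}
  {μ : Measure E} {W : E → ℝ} {B S : ℝ}

theorem HasGenerator.const_mul {f g : E → ℝ} (hfg : M.HasGenerator μ f g) (a : ℝ) :
    M.HasGenerator μ (fun x => a * f x) (fun x => a * g x) := by
  obtain ⟨hf, hg, h_lim⟩ := hfg
  refine ⟨hf.const_mul a, hg.const_mul a, ?_⟩
  have h_smul (t : ℝ≥0) :
      eLpNorm (fun x => (M.semigroup t (fun x => a * f x) x - a * f x) / (t : ℝ) - a * g x) 2 μ =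
        ‖a‖ₑ * eLpNorm (fun x => (M.semigroup t f x - f x) / (t : ℝ) - g x) 2 μ := by
    rw [← eLpNorm_const_smul]
    congr 1 with x
    simp only [semigroup, integral_const_mul, Pi.smul_apply, smul_eq_mul]
    ring
  simp_rw [h_smul]
  simpa using ENNReal.Tendsto.const_mul h_lim (Or.inr enorm_ne_top)

theorem HasGenerator.integral_add_le_of_Lam_le (hS : M.Lam μ W ≤ S) {f g : E → ℝ}
    (hfg : M.HasGenerator μ f g) (hf : ∫ x, f x ^ 2 ∂μ = 1)
    (hWf : Integrable (fun x => W x * f x ^ 2) μ) :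
    ∫ x, W x * f x ^ 2 ∂μ + ∫ x, g x * f x ∂μ ≤ S := by
  rw [← EReal.coe_le_coe_iff, EReal.coe_add, coe_integral_eq_lintegral_ofReal_sub hWf]
  refine le_trans (le_sSup ?_) hS
  exact ⟨f, g, hfg, hf, rfl⟩

theorem HasGenerator.integral_add_le_mul_of_Lam_le (hS : M.Lam μ W ≤ S) {f g : E → ℝ}
    (hfg : M.HasGenerator μ f g) (hWf : Integrable (fun x => W x * f x ^ 2) μ) :
    ∫ x, W x * f x ^ 2 ∂μ + ∫ x, g x * f x ∂μ ≤ S * ∫ x, f x ^ 2 ∂μ := by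
  rcases (integral_nonneg fun x => sq_nonneg (f x) : 0 ≤ ∫ x, f x ^ 2 ∂μ).eq_or_lt' with
    h_zero | h_pos
  · have hf_zero : f =ᵐ[μ] 0 := by
      filter_upwards [(integral_eq_zero_iff_of_nonneg (fun x => sq_nonneg (f x))
        hfg.1.integrable_sq).mp h_zero] with x hx
      exact pow_eq_zero_iff two_ne_zero |>.mp hx
    rw [h_zero, integral_eq_zero_of_ae (hf_zero.mono fun x hx => by simp [hx]),
      integral_eq_zero_of_ae (hf_zero.mono fun x hx => by simp [hx])]
    simp
  · set N := ∫ x, f x ^ 2 ∂μ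
    have h_sq : (√N)⁻¹ ^ 2 = N⁻¹ := by rw [inv_pow, Real.sq_sqrt h_pos.le]
    have hW_scaled (x : E) : W x * ((√N)⁻¹ * f x) ^ 2 = N⁻¹ * (W x * f x ^ 2) := by
      rw [← h_sq]; ring
    have hg_scaled (x : E) : (√N)⁻¹ * g x * ((√N)⁻¹ * f x) = N⁻¹ * (g x * f x) := by
      rw [← h_sq]; ring
    have h_le := (hfg.const_mul (√N)⁻¹).integral_add_le_of_Lam_le hS
      (by simp only [mul_pow, integral_const_mul, h_sq]; exact inv_mul_cancel₀ h_pos.ne')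
      (by simpa only [hW_scaled] using hWf.const_mul N⁻¹)
    simp only [hW_scaled, hg_scaled, integral_const_mul] at h_le
    rwa [← mul_add, inv_mul_le_iff₀ h_pos, mul_comm N] at h_le

theorem continuous_pathIntegral_right (hW : Measurable W) (hB : ∀ x, |W x| ≤ B) (a : ℝ) (ω : Ω) :
    Continuous fun b => M.pathIntegral W a b ω :=
  intervalIntegral.continuous_primitive (intervalIntegrable_path hW hB ω) a

theorem continuous_feynmanKac (hW : Measurable W) (hB : ∀ x, |W x| ≤ B) (x : E) :
    Continuous fun t => M.feynmanKac W t x := by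
  refine continuous_iff_continuousAt.mpr fun t => ?_
  refine continuousAt_of_dominated (bound := fun _ => Real.exp (|B| * (|t| + 1)))
    (Eventually.of_forall fun s => (measurable_pathIntegral hW 0 s).exp.aestronglyMeasurable) ?_
    (integrable_const _) (Eventually.of_forall fun ω =>
      (continuous_pathIntegral_right hW hB 0 ω).rexp.continuousAt)
  have h_near : ∀ᶠ s in 𝓝 t, |s| ≤ |t| + 1 :=
    (continuous_abs.tendsto t).eventually_le_const (lt_add_one _)
  filter_upwards [h_near] with s hs
  refine Eventually.of_forall fun ω => ?_
  rw [Real.norm_of_nonneg (Real.exp_pos _).le]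
  refine (exp_pathIntegral_le hB 0 s ω).trans (Real.exp_le_exp.mpr ?_)
  rw [sub_zero]
  exact mul_le_mul (le_abs_self B) hs (abs_nonneg s) (abs_nonneg B)

theorem continuousOn_integral_feynmanKac_sq [IsFiniteMeasure μ] (hW : Measurable W)
    (hB : ∀ x, |W x| ≤ B) (T : ℝ) :
    ContinuousOn (fun t => ∫ x, M.feynmanKac W t x ^ 2 ∂μ) (Icc 0 T) := by
  refine continuousOn_of_dominated (bound := fun _ => Real.exp (|B| * T) ^ 2)
    (fun t _ => ((measurable_feynmanKac hW t).pow_const 2).aestronglyMeasurable)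
    (fun t ht => Eventually.of_forall fun x => ?_) (integrable_const _)
    (Eventually.of_forall fun x => ((continuous_feynmanKac hW hB x).pow 2).continuousOn)
  rw [norm_pow, Real.norm_eq_abs]
  gcongr
  refine (abs_feynmanKac_le hB t x).trans (Real.exp_le_exp.mpr ?_)
  rw [abs_of_nonneg ht.1]
  exact mul_le_mul (le_abs_self B) ht.2 ht.1 (abs_nonneg B)

theorem IsInvariant.integral_feynmanKac_mul_deriv_le [IsProbabilityMeasure μ]
    (hμ : M.IsInvariant μ) (hW : Measurable W) (hB : ∀ x, |W x| ≤ B) (hS : M.Lam μ W ≤ S)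
    {t : ℝ} (ht : 0 ≤ t) :
    ∫ x, M.feynmanKac W t x * M.feynmanKacDeriv W t x ∂μ ≤
      S * ∫ x, M.feynmanKac W t x ^ 2 ∂μ := by
  have h_gen := hμ.hasGenerator_feynmanKac hW hB ht
  have hWu_int : Integrable (fun x => W x * M.feynmanKac W t x ^ 2) μ :=
    h_gen.1.integrable_sq.bdd_mul hW.aestronglyMeasurable (Eventually.of_forall hB)
  have hgu_int : Integrable (fun x => (M.feynmanKacDeriv W t x - W x * M.feynmanKac W t x) *
      M.feynmanKac W t x) μ := h_gen.2.1.integrable_mul h_gen.1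
  refine le_trans (le_of_eq ?_) (h_gen.integral_add_le_mul_of_Lam_le hS hWu_int)
  rw [← integral_add hWu_int hgu_int]
  congr with x
  ring

theorem IsInvariant.integral_feynmanKac_sq_le [IsProbabilityMeasure μ] (hμ : M.IsInvariant μ)
    (hW : Measurable W) (hB : ∀ x, |W x| ≤ B) (hS : M.Lam μ W ≤ S) {t : ℝ} (ht : 0 ≤ t) :
    ∫ x, M.feynmanKac W t x ^ 2 ∂μ ≤ Real.exp (2 * S * t) := by
  have h_deriv (s : ℝ) (hs : s ∈ Ico 0 t) := hasDerivWithinAt_integral_sq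
    (fun r => memLp_feynmanKac hW hB r 2) (memLp_feynmanKacDeriv hW hB s 2)
    (hμ.tendsto_eLpNorm_feynmanKac_slope_sub hW hB hs.1)
  have h_le := le_mul_exp_of_hasDerivWithinAt_le (K := 2 * S)
    (continuousOn_integral_feynmanKac_sq hW hB t) h_deriv
    (fun s hs => by linarith [hμ.integral_feynmanKac_mul_deriv_le hW hB hS hs.1])
    (right_mem_Icc.mpr ht)
  have h_zero (x : E) : M.feynmanKac W 0 x = 1 := by simp [feynmanKac, pathIntegral]
  simpa only [h_zero, one_pow, integral_const, probReal_univ, smul_eq_mul, one_mul] using h_le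

end MarkovProcess

theorem exists_le_add_mul_sub_of_concaveOn {f : ℝ → ℝ} {S : Set ℝ} {x : ℝ}
    (hf : ConcaveOn ℝ S f) (hx : x ∈ interior S) : ∃ k, ∀ y ∈ S, f y ≤ f x + k * (y - x) := by
  have hf_neg : ConvexOn ℝ S (-f) := hf.neg
  refine ⟨-derivWithin (-f) (Ioi x) x, fun y hy => ?_⟩
  rcases lt_trichotomy x y with hxy | rfl | hyx
  · have h_slope := hf_neg.rightDeriv_le_slope_of_mem_interior hx hy hxy
    rw [slope_def_field, le_div_iff₀ (sub_pos.mpr hxy), Pi.neg_apply, Pi.neg_apply] at h_slope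
    linarith
  · simp
  · have h_slope := (hf_neg.slope_le_leftDeriv_of_mem_interior hy hx hyx).trans
      (hf_neg.leftDeriv_le_rightDeriv_of_mem_interior hx)
    rw [slope_def_field, div_le_iff₀ (sub_pos.mpr hyx), Pi.neg_apply, Pi.neg_apply] at h_slope
    linarith

section Logarithm

variable {F : ℝ → ℝ} {k : ℝ}

theorem map_pow_le_mul_of_map_mul_le (hF_one : F 1 = 0)
    (hF_sub : ∀ x y : ℝ, 0 < x → 0 < y → F (x * y) ≤ F x + F y) {x : ℝ} (hx : 0 < x) (n : ℕ) :
    F (x ^ n) ≤ n * F x := by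
  induction n with
  | zero => simp [hF_one]
  | succ n ih =>
    calc F (x ^ (n + 1)) ≤ F (x ^ n) + F x := by
          rw [pow_succ]; exact hF_sub _ _ (pow_pos hx n) hx
      _ ≤ (n + 1 : ℕ) * F x := by push_cast; linarith

theorem map_le_mul_log_of_le_mul_sub_one (hF_one : F 1 = 0)
    (hF_sub : ∀ x y : ℝ, 0 < x → 0 < y → F (x * y) ≤ F x + F y)
    (hF_tangent : ∀ x, 0 < x → F x ≤ k * (x - 1)) {x : ℝ} (hx : 0 < x) :
    F x ≤ k * Real.log x := by
  have h_inv : Tendsto (fun n : ℕ => ((n : ℝ) + 1)⁻¹) atTop (𝓝[>] 0) :=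
    tendsto_inv_atTop_nhdsGT_zero.comp
      (tendsto_atTop_add_const_right _ 1 tendsto_natCast_atTop_atTop)
  refine ge_of_tendsto' (((tendsto_rpow_sub_one_log hx).comp h_inv).const_mul k) fun n => ?_
  have h_root : (x ^ ((n : ℝ) + 1)⁻¹) ^ (n + 1) = x := by
    exact_mod_cast Real.rpow_inv_natCast_pow hx.le n.succ_ne_zero
  have h_root_pos : 0 < x ^ ((n : ℝ) + 1)⁻¹ := Real.rpow_pos_of_pos hx _
  calc F x ≤ (n + 1 : ℕ) * F (x ^ ((n : ℝ) + 1)⁻¹) := by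
        simpa only [h_root] using map_pow_le_mul_of_map_mul_le hF_one hF_sub h_root_pos (n + 1)
    _ ≤ (n + 1 : ℕ) * (k * (x ^ ((n : ℝ) + 1)⁻¹ - 1)) := by
        gcongr
        exact hF_tangent _ h_root_pos
    _ = k * (((n : ℝ) + 1)⁻¹⁻¹ * (x ^ ((n : ℝ) + 1)⁻¹ - 1)) := by push_cast; rw [inv_inv]; ring

theorem exists_eqOn_mul_log_of_concaveOn (hF_mono : StrictMonoOn F (Ioi 0))
    (hF_conc : ConcaveOn ℝ (Ioi 0) F) (hF_one : F 1 = 0)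
    (hF_sub : ∀ x y : ℝ, 0 < x → 0 < y → F (x * y) ≤ F x + F y) :
    ∃ k, 0 < k ∧ EqOn F (fun x => k * Real.log x) (Ioi 0) := by
  obtain ⟨k, hk⟩ := exists_le_add_mul_sub_of_concaveOn hF_conc
    (show (1 : ℝ) ∈ interior (Ioi 0) by simp)
  simp only [hF_one, zero_add] at hk
  have h_le {x : ℝ} (hx : 0 < x) : F x ≤ k * Real.log x :=
    map_le_mul_log_of_le_mul_sub_one hF_one hF_sub hk hx
  have h_two_pos : 0 < F 2 := by
    simpa only [hF_one] using hF_mono (mem_Ioi.mpr one_pos) (mem_Ioi.mpr two_pos) one_lt_two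
  refine ⟨k, by linarith [hk 2 (mem_Ioi.mpr two_pos)], fun x hx => le_antisymm (h_le hx) ?_⟩
  have hx_ne : x ≠ 0 := (mem_Ioi.mp hx).ne'
  have h_inv := h_le (inv_pos.mpr (mem_Ioi.mp hx))
  have h_sum := hF_sub x x⁻¹ hx (inv_pos.mpr hx)
  rw [mul_inv_cancel₀ hx_ne, hF_one] at h_sum
  rw [Real.log_inv] at h_inv
  linarith

theorem valueAtZero_eq_bot (hk : 0 < k) (hF : EqOn F (fun x => k * Real.log x) (Ioi 0)) :
    valueAtZero F = ⊥ := by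
  refine EReal.eq_bot_iff_forall_lt _ |>.mpr fun y => ?_
  refine (iInf_le _ ⟨Real.exp ((y - 1) / k), Real.exp_pos _⟩).trans_lt ?_
  simp only [hF (Real.exp_pos _), Real.log_exp, mul_div_cancel₀ _ hk.ne', EReal.coe_lt_coe_iff]
  exact sub_one_lt y

theorem inverseF_eq_exp (hk : 0 < k) (hF : EqOn F (fun x => k * Real.log x) (Ioi 0)) (y : ℝ) :
    inverseF F y = Real.exp (k⁻¹ * y) := by
  have h_exists : ∃ a ∈ Ioi (0 : ℝ), F a = y :=
    ⟨Real.exp (k⁻¹ * y), Real.exp_pos _, by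
      simp only [hF (Real.exp_pos _), Real.log_exp, mul_inv_cancel_left₀ hk.ne']⟩
  have h_pos : 0 < inverseF F y := Function.invFunOn_mem h_exists
  have h_eq : F (inverseF F y) = y := Function.invFunOn_eq h_exists
  simp only [hF h_pos] at h_eq
  rw [← (eq_inv_mul_iff_mul_eq₀ hk.ne').mpr h_eq, Real.exp_log h_pos]

end Logarithm

section SobolevFunctional

variable {E : Type*} [MeasurableSpace E] {μ : Measure E} {F : ℝ → ℝ} {k : ℝ} {W V : E → ℝ}

theorem lambdaMax_eq_top (hF : valueAtZero F = ⊥) (V : E → ℝ) : lambdaMax μ F V = ⊤ := by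
  refine top_le_iff.mp (le_sSup fun c _ _ => Eventually.of_forall fun x => ?_)
  rw [hF]
  exact EReal.bot_lt_coe _

theorem sobolevFunctional_eq_mul_cgf [IsProbabilityMeasure μ] (hk : 0 < k)
    (hF : EqOn F (fun x => k * Real.log x) (Ioi 0))
    (hW_exp : Integrable (fun x => Real.exp (k⁻¹ * W x)) μ) :
    sobolevFunctional μ F W = ((k * cgf W μ k⁻¹ : ℝ) : EReal) := by
  have h_pos : 0 < mgf W μ k⁻¹ := mgf_pos hW_exp
  have h_lintegral : ∫⁻ x, ENNReal.ofReal (inverseF F (W x)) ∂μ =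
      ENNReal.ofReal (mgf W μ k⁻¹) := by
    simp_rw [inverseF_eq_exp hk hF]
    exact (ofReal_integral_eq_lintegral_ofReal hW_exp
      (Eventually.of_forall fun _ => (Real.exp_pos _).le)).symm
  rw [sobolevFunctional, h_lintegral, extendF, if_neg (ENNReal.ofReal_pos.mpr h_pos).ne',
    if_neg ENNReal.ofReal_ne_top, ENNReal.toReal_ofReal h_pos.le, hF h_pos, cgf]

theorem sobolevFunctional_eq_top (hk : 0 < k) (hF : EqOn F (fun x => k * Real.log x) (Ioi 0))
    (hW : Measurable W) (hW_exp : ¬ Integrable (fun x => Real.exp (k⁻¹ * W x)) μ) :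
    sobolevFunctional μ F W = ⊤ := by
  have h_lintegral : ∫⁻ x, ENNReal.ofReal (inverseF F (W x)) ∂μ = ∞ := by
    simp_rw [inverseF_eq_exp hk hF]
    contrapose! hW_exp
    exact (lintegral_ofReal_ne_top_iff_integrable (hW.const_mul k⁻¹).exp.aestronglyMeasurable
      (Eventually.of_forall fun _ => (Real.exp_pos _).le)).mp hW_exp
  rw [sobolevFunctional, h_lintegral, extendF, if_neg ENNReal.top_ne_zero, if_pos rfl]

theorem sobolevFunctional_sub_const [IsProbabilityMeasure μ] (hk : 0 < k)
    (hF : EqOn F (fun x => k * Real.log x) (Ioi 0)) (hW : Measurable W) (m : ℝ) :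
    sobolevFunctional μ F (fun x => W x - m) = sobolevFunctional μ F W - (m : EReal) := by
  have h_exp (x : E) :
      Real.exp (k⁻¹ * (W x - m)) = Real.exp (k⁻¹ * W x) * Real.exp (k⁻¹ * -m) := by
    rw [← Real.exp_add, ← mul_add, sub_eq_add_neg]
  have h_integrable : Integrable (fun x => Real.exp (k⁻¹ * (W x - m))) μ ↔
      Integrable (fun x => Real.exp (k⁻¹ * W x)) μ := by
    simp only [h_exp]
    exact integrable_mul_const_iff (Real.exp_pos _).ne'.isUnit _
  by_cases hW_exp : Integrable (fun x => Real.exp (k⁻¹ * W x)) μ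
  · rw [sobolevFunctional_eq_mul_cgf hk hF hW_exp,
      sobolevFunctional_eq_mul_cgf hk hF (h_integrable.mpr hW_exp), ← EReal.coe_sub]
    simp only [cgf, sub_eq_add_neg, mgf_add_const]
    rw [Real.log_mul (mgf_pos hW_exp).ne' (Real.exp_pos _).ne', Real.log_exp, mul_add,
      mul_inv_cancel_left₀ hk.ne']
  · rw [sobolevFunctional_eq_top hk hF hW hW_exp,
      sobolevFunctional_eq_top hk hF (hW.sub_const m) (mt h_integrable.mp hW_exp),
      EReal.top_sub_coe]

theorem HstarC_eq_Hstar [IsProbabilityMeasure μ] (hk : 0 < k)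
    (hF : EqOn F (fun x => k * Real.log x) (Ioi 0)) (hV : Measurable V) (R : ℝ) :
    HstarC μ F V R = Hstar μ F V (R + ∫ x, V x ∂μ) := by
  have h_bot := valueAtZero_eq_bot hk hF
  simp only [HstarC, Hstar, lambdaMax_eq_top h_bot, mul_sub]
  refine iSup_congr fun c => iSup_congr fun _ => ?_
  rw [sobolevFunctional_sub_const hk hF (hV.const_mul c), mul_add]
  induction sobolevFunctional μ F (fun x => c * V x) with
  | bot => rw [EReal.bot_sub, EReal.coe_sub_bot, EReal.coe_sub_bot]
  | top => rw [EReal.top_sub_coe, EReal.sub_top, EReal.sub_top]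
  | coe s =>
    simp only [← EReal.coe_sub]
    congr 1
    ring

end SobolevFunctional

theorem mul_le_mul_log_sub_self_add_exp (w : ℝ) {s : ℝ} (hs : 0 ≤ s) :
    w * s ≤ s * Real.log s - s + Real.exp w := by
  rcases hs.eq_or_lt with rfl | hs
  · simpa using (Real.exp_pos w).le
  · have h_log := Real.log_le_sub_one_of_pos (div_pos (Real.exp_pos w) hs)
    rw [Real.log_div (Real.exp_pos w).ne' hs.ne', Real.log_exp] at h_log
    have h_mul := mul_le_mul_of_nonneg_left h_log hs.le
    rw [mul_sub, mul_sub, mul_div_cancel₀ _ hs.ne'] at h_mul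
    linarith

section ExponentialTilt

variable {α : Type*} [MeasurableSpace α] {μ : Measure α} [IsProbabilityMeasure μ] {X : α → ℝ}
  {t : ℝ}

theorem exp_mul_sub_cgf (hX : Integrable (fun x => Real.exp (t * X x)) μ) (x : α) :
    Real.exp (t * X x - cgf X μ t) = (mgf X μ t)⁻¹ * Real.exp (t * X x) := by
  rw [sub_eq_neg_add, Real.exp_add, Real.exp_neg, exp_cgf hX]

theorem integrable_exp_mul_sub_cgf (hX : Integrable (fun x => Real.exp (t * X x)) μ) :
    Integrable (fun x => Real.exp (t * X x - cgf X μ t)) μ := by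
  simpa only [exp_mul_sub_cgf hX] using hX.const_mul _

theorem integral_exp_mul_sub_cgf (hX : Integrable (fun x => Real.exp (t * X x)) μ) :
    ∫ x, Real.exp (t * X x - cgf X μ t) ∂μ = 1 := by
  simp only [exp_mul_sub_cgf hX, integral_const_mul]
  exact inv_mul_cancel₀ (mgf_pos hX).ne'

end ExponentialTilt

theorem lintegral_ofReal_sub_lintegral_ofReal_neg_le {α : Type*} [MeasurableSpace α]
    {μ : Measure α} {φ Φ : α → ℝ} (hφ : AEStronglyMeasurable φ μ) (hΦ : Integrable Φ μ)
    (h_le : ∀ x, φ x ≤ Φ x) :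
    ((∫⁻ x, ENNReal.ofReal (φ x) ∂μ : ℝ≥0∞) : EReal) -
      ((∫⁻ x, ENNReal.ofReal (-φ x) ∂μ : ℝ≥0∞) : EReal) ≤ ((∫ x, Φ x ∂μ : ℝ) : EReal) := by
  by_cases h_neg : ∫⁻ x, ENNReal.ofReal (-φ x) ∂μ = ∞
  · rw [h_neg, EReal.coe_ennreal_top, EReal.sub_top]
    exact bot_le
  · have h_lower (x : α) : -(ENNReal.ofReal (-φ x)).toReal ≤ φ x := by
      rw [ENNReal.toReal_ofReal', neg_le]
      exact le_max_left _ _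
    have hφ_int : Integrable φ μ := integrable_of_le_of_le hφ
      (Eventually.of_forall h_lower) (Eventually.of_forall h_le)
      (integrable_toReal_of_lintegral_ne_top hφ.aemeasurable.neg.ennreal_ofReal h_neg).neg hΦ
    rw [← coe_integral_eq_lintegral_ofReal_sub hφ_int, EReal.coe_le_coe_iff]
    exact integral_mono hφ_int hΦ h_le

namespace MarkovProcess

variable {E Ω : Type*} [MeasurableSpace E] [MeasurableSpace Ω] {M : MarkovProcess E Ω}
  {μ : Measure E} {F : ℝ → ℝ} {k : ℝ} {W : E → ℝ}

theorem FSobolev.exists_integrable_ge [IsProbabilityMeasure μ] (hSob : M.FSobolev μ F)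
    (hk : 0 < k) (hF : EqOn F (fun x => k * Real.log x) (Ioi 0))
    (hW_exp : Integrable (fun x => Real.exp (k⁻¹ * W x)) μ) {f g : E → ℝ}
    (hfg : M.HasGenerator μ f g) (hf : ∫ x, f x ^ 2 ∂μ = 1) :
    ∃ Φ : E → ℝ, Integrable Φ μ ∧ (∀ x, W x * f x ^ 2 ≤ Φ x) ∧
      ∫ x, Φ x ∂μ + ∫ x, g x * f x ∂μ ≤ k * cgf W μ k⁻¹ := by
  obtain ⟨hF_int, hF_le⟩ := hSob f g hfg hf
  set c := cgf W μ k⁻¹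
  have hf_int : Integrable (fun x => f x ^ 2) μ := hfg.1.integrable_sq
  have h_tilt_int := integrable_exp_mul_sub_cgf hW_exp
  have h_log (x : E) : f x ^ 2 * F (f x ^ 2) = k * (f x ^ 2 * Real.log (f x ^ 2)) := by
    rcases (sq_nonneg (f x)).eq_or_lt' with h_zero | h_pos
    · simp [h_zero]
    · rw [hF h_pos]; ring
  -- Young's inequality with `s = f²` and `w = W / k - c`, for which `∫ eʷ dμ = 1`.
  refine ⟨fun x => f x ^ 2 * F (f x ^ 2) + k * (c - 1) * f x ^ 2 +
    k * Real.exp (k⁻¹ * W x - c),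
    (hF_int.add (hf_int.const_mul _)).add (h_tilt_int.const_mul k), fun x => ?_, ?_⟩
  · calc W x * f x ^ 2 = k * ((k⁻¹ * W x - c) * f x ^ 2) + k * c * f x ^ 2 := by
          field_simp
          ring
      _ ≤ k * (f x ^ 2 * Real.log (f x ^ 2) - f x ^ 2 + Real.exp (k⁻¹ * W x - c)) +
          k * c * f x ^ 2 := by
          gcongr
          exact mul_le_mul_log_sub_self_add_exp _ (sq_nonneg _)
      _ = _ := by beta_reduce; rw [h_log]; ring
  · beta_reduce
    rw [integral_add (f := fun x => f x ^ 2 * F (f x ^ 2) + k * (c - 1) * f x ^ 2)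
        (hF_int.add (hf_int.const_mul _)) (h_tilt_int.const_mul k),
      integral_add hF_int (hf_int.const_mul _), integral_const_mul, integral_const_mul, hf,
      integral_exp_mul_sub_cgf hW_exp]
    linarith

theorem FSobolev.Lam_le [IsProbabilityMeasure μ] (hSob : M.FSobolev μ F) (hk : 0 < k)
    (hF : EqOn F (fun x => k * Real.log x) (Ioi 0)) (hW : Measurable W) :
    M.Lam μ W ≤ sobolevFunctional μ F W := by
  by_cases hW_exp : Integrable (fun x => Real.exp (k⁻¹ * W x)) μ
  · rw [sobolevFunctional_eq_mul_cgf hk hF hW_exp]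
    refine sSup_le ?_
    rintro _ ⟨f, g, hfg, hf, rfl⟩
    obtain ⟨Φ, hΦ, h_le, h_bound⟩ := hSob.exists_integrable_ge hk hF hW_exp hfg hf
    have hWf : AEStronglyMeasurable (fun x => W x * f x ^ 2) μ :=
      hW.aestronglyMeasurable.mul (hfg.1.aestronglyMeasurable.pow 2)
    refine (add_le_add_left
      (lintegral_ofReal_sub_lintegral_ofReal_neg_le hWf hΦ h_le) _).trans ?_
    exact_mod_cast h_bound
  · rw [sobolevFunctional_eq_top hk hF hW hW_exp]
    exact le_top

end MarkovProcess

section DensityNorm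

variable {E : Type*} [MeasurableSpace E] {μ ν : Measure E} [SigmaFinite μ]

theorem densityNorm_ne_zero [SigmaFinite ν] [NeZero ν] (hν : ν ≪ μ) : densityNorm ν μ ≠ 0 := by
  intro h_zero
  rw [densityNorm, eLpNorm_eq_zero_iff
    (Measure.measurable_rnDeriv ν μ).ennreal_toReal.aestronglyMeasurable two_ne_zero] at h_zero
  have h_rnDeriv : ν.rnDeriv μ =ᵐ[μ] 0 := by
    filter_upwards [h_zero, ν.rnDeriv_lt_top μ] with x hx hx_top
    exact (ENNReal.toReal_eq_zero_iff _).mp hx |>.resolve_right hx_top.ne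
  exact NeZero.ne ν (Measure.eq_zero_of_absolutelyContinuous_of_mutuallySingular hν
    ((Measure.rnDeriv_eq_zero ν μ).mp h_rnDeriv))

theorem densityNorm_self [IsProbabilityMeasure μ] : densityNorm μ μ = 1 := by
  have h_ae : (fun x => (μ.rnDeriv μ x).toReal) =ᵐ[μ] fun _ => 1 :=
    (Measure.rnDeriv_self μ).mono fun x hx => by simp [hx]
  rw [densityNorm, eLpNorm_congr_ae h_ae, eLpNorm_const _ two_ne_zero (NeZero.ne μ)]
  simp

theorem lintegral_enorm_le_densityNorm_mul_eLpNorm [SigmaFinite ν] (hν : ν ≪ μ) {u : E → ℝ}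
    (hu : Measurable u) : ∫⁻ x, ‖u x‖ₑ ∂ν ≤ densityNorm ν μ * eLpNorm u 2 μ := by
  have h_mul : ∫⁻ x, ‖u x‖ₑ ∂ν = eLpNorm ((fun x => (ν.rnDeriv μ x).toReal) • u) 1 μ := by
    rw [← lintegral_rnDeriv_mul hν hu.enorm.aemeasurable, eLpNorm_one_eq_lintegral_enorm]
    refine lintegral_congr_ae ((ν.rnDeriv_lt_top μ).mono fun x hx => ?_)
    simp [enorm_mul, Real.enorm_of_nonneg ENNReal.toReal_nonneg, ENNReal.ofReal_toReal hx.ne]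
  rw [h_mul]
  exact eLpNorm_smul_le_mul_eLpNorm hu.aestronglyMeasurable
    (Measure.measurable_rnDeriv ν μ).ennreal_toReal.aestronglyMeasurable

end DensityNorm

theorem le_mul_exp_neg_mul_iff {P D : ℝ≥0∞} {h : EReal} {t : ℝ} (ht : 0 < t) (hD_zero : D ≠ 0)
    (hD_top : D ≠ ∞) :
    P ≤ D * EReal.exp (-((t : EReal) * h)) ↔ h ≤ -(P / D).log / (t : EReal) := by
  rw [mul_comm D, ← ENNReal.div_le_iff_le_mul (Or.inl hD_zero) (Or.inl hD_top),
    ← ENNReal.exp_log (P / D), EReal.exp_le_exp_iff, ENNReal.exp_log, EReal.le_neg,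
    EReal.le_div_iff_mul_le (EReal.coe_pos.mpr ht) (EReal.coe_ne_top t), mul_comm h]

theorem measure_ge_le_mul_exp_of_lintegral_exp_le {Ω : Type*} [MeasurableSpace Ω] {P : Measure Ω}
    {X : Ω → ℝ} (hX : Measurable X) {D : ℝ≥0∞} {S : ℝ}
    (h_le : ∫⁻ ω, ENNReal.ofReal (Real.exp (X ω)) ∂P ≤ D * ENNReal.ofReal (Real.exp S)) (a : ℝ) :
    P {ω | a ≤ X ω} ≤ D * ENNReal.ofReal (Real.exp (-(a - S))) := by
  have h_exp (ω : Ω) : a ≤ X ω ↔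
      ENNReal.ofReal (Real.exp a) ≤ ENNReal.ofReal (Real.exp (X ω)) := by
    rw [ENNReal.ofReal_le_ofReal_iff (Real.exp_pos _).le, Real.exp_le_exp]
  simp only [h_exp]
  refine (meas_ge_le_lintegral_div hX.exp.ennreal_ofReal.aemeasurable
    (ENNReal.ofReal_pos.mpr (Real.exp_pos a)).ne' ENNReal.ofReal_ne_top).trans ?_
  rw [neg_sub, Real.exp_sub, ENNReal.ofReal_div_of_pos (Real.exp_pos a), ← mul_div_assoc]
  gcongr

section Truncation

variable {α : Type*} {f : α → ℝ}

theorem measurable_truncation [MeasurableSpace α] (hf : Measurable f) (A : ℝ) :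
    Measurable (truncation f A) :=
  (measurable_id.indicator measurableSet_Ioc).comp hf

theorem tendsto_truncation_natCast (f : α → ℝ) (x : α) :
    Tendsto (fun n : ℕ => truncation f n x) atTop (𝓝 (f x)) := by
  refine tendsto_const_nhds.congr' ?_
  filter_upwards [tendsto_natCast_atTop_atTop.eventually_gt_atTop |f x|] with n hn
  exact (truncation_eq_self hn).symm

theorem exp_mul_truncation_le (f : α → ℝ) (t A : ℝ) (x : α) :
    Real.exp (t * truncation f A x) ≤ Real.exp (t * f x) + 1 := by
  by_cases hx : f x ∈ Ioc (-A) A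
  · simp [truncation, indicator_of_mem hx]
  · simp [truncation, indicator_of_notMem hx, (Real.exp_pos _).le]

theorem tendsto_cgf_truncation [MeasurableSpace α] {μ : Measure α} [IsProbabilityMeasure μ]
    (hf : Measurable f) {t : ℝ} (hf_exp : Integrable (fun x => Real.exp (t * f x)) μ) :
    Tendsto (fun n : ℕ => cgf (truncation f n) μ t) atTop (𝓝 (cgf f μ t)) := by
  refine Tendsto.log (tendsto_integral_of_dominated_convergence (fun x => Real.exp (t * f x) + 1)
    (fun n => ((measurable_truncation hf n).const_mul t).exp.aestronglyMeasurable)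
    (hf_exp.add (integrable_const 1)) (fun n => Eventually.of_forall fun x => ?_)
    (Eventually.of_forall fun x => ((tendsto_truncation_natCast f x).const_mul t).rexp))
    (mgf_pos hf_exp).ne'
  rw [Real.norm_of_nonneg (Real.exp_pos _).le]
  exact exp_mul_truncation_le f t n x

end Truncation

namespace MarkovProcess

variable {E Ω : Type*} [MeasurableSpace E] [MeasurableSpace Ω] {M : MarkovProcess E Ω}
  {μ ν : Measure E} {F : ℝ → ℝ} {k : ℝ} {W V : E → ℝ} {B S : ℝ}

theorem initLaw_absolutelyContinuous (hν : ν ≪ μ) : M.initLaw ν ≪ M.initLaw μ :=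
  hν.comp_right M.law

variable [IsProbabilityMeasure μ]

theorem IsInvariant.eLpNorm_feynmanKac_le (hμ : M.IsInvariant μ) (hW : Measurable W)
    (hB : ∀ x, |W x| ≤ B) (hS : M.Lam μ W ≤ S) {t : ℝ} (ht : 0 ≤ t) :
    eLpNorm (M.feynmanKac W t) 2 μ ≤ ENNReal.ofReal (Real.exp (t * S)) := by
  have h_memLp : MemLp (M.feynmanKac W t) 2 μ := memLp_feynmanKac hW hB t 2
  rw [ENNReal.le_ofReal_iff_toReal_le h_memLp.2.ne (Real.exp_pos _).le, ← Lp.norm_toLp _ h_memLp]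
  refine (sq_le_sq₀ (norm_nonneg _) (Real.exp_pos _).le).mp ?_
  rw [norm_sq_toLp_eq_integral_sq, ← Real.exp_nat_mul]
  refine (hμ.integral_feynmanKac_sq_le hW hB hS ht).trans_eq ?_
  push_cast
  ring_nf

theorem IsInvariant.lintegral_exp_pathIntegral_le [SigmaFinite ν] (hμ : M.IsInvariant μ)
    (hν : ν ≪ μ) (hW : Measurable W) (hB : ∀ x, |W x| ≤ B) (hS : M.Lam μ W ≤ S) {t : ℝ}
    (ht : 0 ≤ t) :
    ∫⁻ ω, ENNReal.ofReal (Real.exp (M.pathIntegral W 0 t ω)) ∂(M.initLaw ν) ≤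
      densityNorm ν μ * ENNReal.ofReal (Real.exp (t * S)) := by
  have h_feynmanKac (x : E) : ∫⁻ ω, ENNReal.ofReal (Real.exp (M.pathIntegral W 0 t ω)) ∂(M.law x) =
      ‖M.feynmanKac W t x‖ₑ := by
    rw [Real.enorm_of_nonneg (feynmanKac_nonneg t x), feynmanKac,
      ofReal_integral_eq_lintegral_ofReal (integrable_exp_pathIntegral hW hB 0 t _)
        (Eventually.of_forall fun _ => (Real.exp_pos _).le)]
  rw [lintegral_initLaw ν (measurable_pathIntegral hW 0 t).exp.ennreal_ofReal]
  simp only [h_feynmanKac]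
  refine (lintegral_enorm_le_densityNorm_mul_eLpNorm hν (measurable_feynmanKac hW t)).trans ?_
  gcongr
  exact hμ.eLpNorm_feynmanKac_le hW hB hS ht

theorem IsInvariant.ae_intervalIntegrable_path (hμ : M.IsInvariant μ)
    (hν : ν ≪ μ) (hV : Measurable V) (hV_int : Integrable V μ) {t : ℝ} (ht : 0 ≤ t) :
    ∀ᵐ ω ∂(M.initLaw ν), IntervalIntegrable (fun s : ℝ => V (M.X s.toNNReal ω)) volume 0 t := by
  refine (initLaw_absolutelyContinuous hν).ae_le ?_
  have h_meas : Measurable fun p : Ω × ℝ => ‖V (M.X p.2.toNNReal p.1)‖ₑ :=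
    ((M.measurable_path hV).comp measurable_swap).enorm
  have h_stationary (s : ℝ) :
      ∫⁻ ω, ‖V (M.X s.toNNReal ω)‖ₑ ∂(M.initLaw μ) = ∫⁻ x, ‖V x‖ₑ ∂μ := by
    conv_rhs => rw [← hμ.map_eval s.toNNReal, lintegral_map hV.enorm (M.measurable_eval _)]
  have h_finite :
      ∫⁻ ω, (∫⁻ s in Ioc 0 t, ‖V (M.X s.toNNReal ω)‖ₑ) ∂(M.initLaw μ) ≠ ∞ := by
    rw [lintegral_lintegral_swap h_meas.aemeasurable]
    simp only [h_stationary, setLIntegral_const]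
    exact ENNReal.mul_ne_top hV_int.2.ne (by simp)
  filter_upwards [ae_lt_top h_meas.lintegral_prod_right' h_finite] with ω hω
  rw [intervalIntegrable_iff_integrableOn_Ioc_of_le ht]
  exact ⟨((M.measurable_path hV).comp measurable_prodMk_right).aestronglyMeasurable, hω⟩

theorem tendsto_pathIntegral_truncation (hV : Measurable V) {t : ℝ} {ω : Ω}
    (hω : IntervalIntegrable (fun s : ℝ => V (M.X s.toNNReal ω)) volume 0 t) :
    Tendsto (fun n : ℕ => M.pathIntegral (truncation V n) 0 t ω) atTop
      (𝓝 (M.pathIntegral V 0 t ω)) :=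
  intervalIntegral.tendsto_integral_filter_of_dominated_convergence
    (fun s => |V (M.X s.toNNReal ω)|)
    (Eventually.of_forall fun n => ((M.measurable_path (measurable_truncation hV n)).comp
      measurable_prodMk_right).aestronglyMeasurable)
    (Eventually.of_forall fun n => Eventually.of_forall fun _ _ =>
      abs_truncation_le_abs_self V n _) hω.abs
    (Eventually.of_forall fun _ _ => tendsto_truncation_natCast V _)

theorem FSobolev.lintegral_exp_pathIntegral_le [SigmaFinite ν] (hSob : M.FSobolev μ F)
    (hk : 0 < k) (hF : EqOn F (fun x => k * Real.log x) (Ioi 0)) (hμ : M.IsInvariant μ)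
    (hν : ν ≪ μ) (hV : Measurable V) (hV_int : Integrable V μ)
    (hV_exp : Integrable (fun x => Real.exp (k⁻¹ * V x)) μ) {t : ℝ} (ht : 0 ≤ t) :
    ∫⁻ ω, ENNReal.ofReal (Real.exp (M.pathIntegral V 0 t ω)) ∂(M.initLaw ν) ≤
      densityNorm ν μ * ENNReal.ofReal (Real.exp (t * (k * cgf V μ k⁻¹))) := by
  have hW (n : ℕ) : Measurable (truncation V n) := measurable_truncation hV n
  have h_bounded (n : ℕ) : ∫⁻ ω, ENNReal.ofReal (Real.exp
      (M.pathIntegral (truncation V n) 0 t ω)) ∂(M.initLaw ν) ≤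
      densityNorm ν μ * ENNReal.ofReal (Real.exp (t * (k * cgf (truncation V n) μ k⁻¹))) := by
    refine hμ.lintegral_exp_pathIntegral_le hν (hW n) (abs_truncation_le_bound V n) ?_ ht
    refine (hSob.Lam_le hk hF (hW n)).trans_eq (sobolevFunctional_eq_mul_cgf hk hF ?_)
    exact integrable_exp_mul_of_le k⁻¹ |(n : ℝ)| (inv_nonneg.mpr hk.le) (hW n).aemeasurable
      (Eventually.of_forall fun x => (le_abs_self _).trans (abs_truncation_le_bound V n x))
  have h_lim : Tendsto (fun n : ℕ => densityNorm ν μ *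
      ENNReal.ofReal (Real.exp (t * (k * cgf (truncation V n) μ k⁻¹)))) atTop
      (𝓝 (densityNorm ν μ * ENNReal.ofReal (Real.exp (t * (k * cgf V μ k⁻¹))))) :=
    ENNReal.Tendsto.const_mul (ENNReal.tendsto_ofReal
      (((tendsto_cgf_truncation hV hV_exp).const_mul k).const_mul t).rexp)
      (Or.inl (ENNReal.ofReal_pos.mpr (Real.exp_pos _)).ne')
  have h_liminf : ∀ᵐ ω ∂(M.initLaw ν), ENNReal.ofReal (Real.exp (M.pathIntegral V 0 t ω)) =
      liminf (fun n : ℕ => ENNReal.ofReal (Real.exp (M.pathIntegral (truncation V n) 0 t ω)))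
        atTop := by
    filter_upwards [hμ.ae_intervalIntegrable_path hν hV hV_int ht] with ω hω
    exact (ENNReal.tendsto_ofReal
      (tendsto_pathIntegral_truncation hV hω).rexp).liminf_eq.symm
  rw [lintegral_congr_ae h_liminf, ← h_lim.liminf_eq]
  exact (lintegral_liminf_le fun n => (measurable_pathIntegral (hW n) 0 t).exp.ennreal_ofReal).trans
    (liminf_le_liminf (Eventually.of_forall h_bounded))

theorem pathIntegral_const_mul_eq_mul_timeAverage (c : ℝ) {t : ℝ} (ht : t ≠ 0) (ω : Ω) :
    M.pathIntegral (fun x => c * V x) 0 t ω = t * (c * M.timeAverage V t ω) := by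
  rw [pathIntegral, intervalIntegral.integral_const_mul, timeAverage]
  field_simp

theorem FSobolev.initLaw_timeAverage_ge_le [SigmaFinite ν] [NeZero ν] (hSob : M.FSobolev μ F)
    (hk : 0 < k) (hF : EqOn F (fun x => k * Real.log x) (Ioi 0)) (hμ : M.IsInvariant μ)
    (hν : ν ≪ μ) (hV : Measurable V) (hV_int : Integrable V μ) {t : ℝ} (ht : 0 < t) (a : ℝ)
    {c : ℝ} (hc : 0 ≤ c) :
    M.initLaw ν {ω | a ≤ M.timeAverage V t ω} ≤ densityNorm ν μ * EReal.exp
      (-((t : EReal) * (((c * a : ℝ) : EReal) - sobolevFunctional μ F (fun x => c * V x)))) := by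
  by_cases hV_exp : Integrable (fun x => Real.exp (k⁻¹ * (c * V x))) μ
  · have h_moment := hSob.lintegral_exp_pathIntegral_le hk hF hμ hν (hV.const_mul c)
      (hV_int.const_mul c) hV_exp ht.le
    have h_subset : {ω | a ≤ M.timeAverage V t ω} ⊆
        {ω | t * (c * a) ≤ M.pathIntegral (fun x => c * V x) 0 t ω} := fun ω hω => by
      rw [mem_ofPred_eq, pathIntegral_const_mul_eq_mul_timeAverage c ht.ne']
      gcongr
      exact hω
    rw [sobolevFunctional_eq_mul_cgf hk hF hV_exp, ← EReal.coe_sub, ← EReal.coe_mul,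
      ← EReal.coe_neg, EReal.exp_coe, mul_sub]
    exact (measure_mono h_subset).trans (measure_ge_le_mul_exp_of_lintegral_exp_le
      (measurable_pathIntegral (hV.const_mul c) 0 t) h_moment _)
  · rw [sobolevFunctional_eq_top hk hF (hV.const_mul c) hV_exp, EReal.sub_top,
      EReal.coe_mul_bot_of_pos ht, EReal.neg_bot, EReal.exp_top,
      ENNReal.mul_top (densityNorm_ne_zero hν)]
    exact le_top

theorem FSobolev.initLaw_timeAverage_ge_le_Hstar [SigmaFinite ν] [NeZero ν]
    (hSob : M.FSobolev μ F) (hk : 0 < k) (hF : EqOn F (fun x => k * Real.log x) (Ioi 0))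
    (hμ : M.IsInvariant μ) (hν : ν ≪ μ) (hV : Measurable V) (hV_int : Integrable V μ) {t : ℝ}
    (ht : 0 < t) (a : ℝ) :
    M.initLaw ν {ω | a ≤ M.timeAverage V t ω} ≤
      densityNorm ν μ * EReal.exp (-((t : EReal) * Hstar μ F V a)) := by
  have h_finite {ρ : Measure E} [SigmaFinite ρ] [NeZero ρ] (hρ : ρ ≪ μ)
      (hρ_top : densityNorm ρ μ ≠ ∞) : M.initLaw ρ {ω | a ≤ M.timeAverage V t ω} ≤
      densityNorm ρ μ * EReal.exp (-((t : EReal) * Hstar μ F V a)) := by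
    have hρ_zero := densityNorm_ne_zero hρ
    refine (le_mul_exp_neg_mul_iff ht hρ_zero hρ_top).mpr (iSup₂_le fun c hc => ?_)
    exact (le_mul_exp_neg_mul_iff ht hρ_zero hρ_top).mp
      (hSob.initLaw_timeAverage_ge_le hk hF hμ hρ hV hV_int ht a hc.1)
  by_cases hν_top : densityNorm ν μ = ∞
  · by_cases hH : Hstar μ F V a = ⊤
    -- Here the bound reads `∞ * 0 = 0`, and the event is null because it is null under `ℙ_μ`.
    · have h_null := h_finite (Measure.AbsolutelyContinuous.refl μ) (by simp [densityNorm_self])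
      rw [hH, EReal.coe_mul_top_of_pos ht, EReal.neg_top, EReal.exp_bot, mul_zero] at h_null
      rw [initLaw_absolutelyContinuous hν (le_zero_iff.mp h_null)]
      exact zero_le
    · have h_mul : (t : EReal) * Hstar μ F V a ≠ ⊤ := by
        induction h_eq : Hstar μ F V a with
        | bot => simp [EReal.coe_mul_bot_of_pos ht]
        | top => exact absurd h_eq hH
        | coe r => exact EReal.coe_ne_top (t * r)
      rw [hν_top, ENNReal.top_mul (by rwa [Ne, EReal.exp_eq_zero_iff, EReal.neg_eq_bot_iff])]
      exact le_top
  · exact h_finite hν hν_top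

end MarkovProcess

theorem mainTheorem1_general {E Ω : Type*} [MeasurableSpace E] [MeasurableSpace Ω]
    (M : MarkovProcess E Ω) (μ : Measure E) [IsProbabilityMeasure μ] (hμ : M.IsInvariant μ)
    (F : ℝ → ℝ) (hF_mono : StrictMonoOn F (Ioi 0)) (hF_conc : ConcaveOn ℝ (Ioi 0) F)
    (hF_one : F 1 = 0) (hF_sub : ∀ x y : ℝ, 0 < x → 0 < y → F (x * y) ≤ F x + F y)
    (hSob : M.FSobolev μ F) (V : E → ℝ) (hV_meas : Measurable V) (hV_int : Integrable V μ) :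
    (∀ (ν : Measure E) [SigmaFinite ν] [NeZero ν], ν ≪ μ → ∀ t : ℝ, 0 < t → ∀ R : ℝ,
      M.initLaw ν {ω | R ≤ M.timeAverage V t ω - ∫ x, V x ∂μ}
        ≤ densityNorm ν μ * EReal.exp (-((t : EReal) * Hstar μ F V (R + ∫ x, V x ∂μ)))) ∧
    (∀ R : ℝ, HstarC μ F V R = Hstar μ F V (R + ∫ x, V x ∂μ)) ∧
    (∀ W : E → ℝ, Measurable W → M.Lam μ W ≤ sobolevFunctional μ F W) := by
  obtain ⟨k, hk, hF⟩ := exists_eqOn_mul_log_of_concaveOn hF_mono hF_conc hF_one hF_sub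
  refine ⟨fun ν _ _ hν t ht R => ?_, HstarC_eq_Hstar hk hF hV_meas, fun W hW =>
    hSob.Lam_le hk hF hW⟩
  simp only [le_sub_iff_add_le]
  exact hSob.initLaw_timeAverage_ge_le_Hstar hk hF hμ hν hV_meas hV_int ht _

theorem mainTheorem1 {E Ω : Type*} [TopologicalSpace E] [PolishSpace E] [MeasurableSpace E]
    [BorelSpace E] [MeasurableSpace Ω]
    (M : MarkovProcess E Ω) (μ : Measure E) [IsProbabilityMeasure μ] (hμ : M.IsInvariant μ)
    (F : ℝ → ℝ) (hF_cont : ContinuousOn F (Ioi 0)) (hF_mono : StrictMonoOn F (Ioi 0))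
    (hF_conc : ConcaveOn ℝ (Ioi 0) F) (hF_top : Tendsto F atTop atTop) (hF_one : F 1 = 0)
    (hF_sub : ∀ x y : ℝ, 0 < x → 0 < y → F (x * y) ≤ F x + F y)
    (hSob : M.FSobolev μ F)
    (V : E → ℝ) (hV_meas : Measurable V) (hV_int : Integrable V μ) :
    -- the two deviation bounds
    (∀ (ν : Measure E) [IsProbabilityMeasure ν], ν ≪ μ → ∀ t : ℝ, 0 < t → ∀ R : ℝ, 0 < R →
      M.initLaw ν {ω | R ≤ M.timeAverage V t ω - ∫ x, V x ∂μ}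
          ≤ densityNorm ν μ * EReal.exp (-((t : EReal) * Hstar μ F V (R + ∫ x, V x ∂μ))) ∧
      M.initLaw ν {ω | R ≤ M.timeAverage V t ω - ∫ x, V x ∂μ}
          ≤ densityNorm ν μ * EReal.exp (-((t : EReal) * HstarC μ F V R))) ∧
    -- the second one is at least as good as the first one when `F(0) = -∞`
    (valueAtZero F = ⊥ → ∀ R : ℝ, 0 < R → Hstar μ F V (R + ∫ x, V x ∂μ) ≤ HstarC μ F V R) ∧
    -- the bound on `Λ(λ V)`
    (∀ c : ℝ, 0 ≤ c → (c : EReal) < lambdaMax μ F V →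
      M.Lam μ (fun x => c * V x) ≤ sobolevFunctional μ F (fun x => c * V x)) := by
  obtain ⟨h_bound, h_eq, h_Lam⟩ :=
    mainTheorem1_general M μ hμ F hF_mono hF_conc hF_one hF_sub hSob V hV_meas hV_int
  exact ⟨fun ν _ hν t ht R _ => ⟨h_bound ν hν t ht R, h_eq R ▸ h_bound ν hν t ht R⟩,
    fun _ R _ => (h_eq R).ge, fun c _ _ => h_Lam _ (hV_meas.const_mul c)⟩
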